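/- Let $\mathbb H^1=\mathbb R^3$ be the Heisenberg group with coordinates $(x,y,t)$, $X=\partial_x+y\,\partial_t$, $Y=\partial_y-x\,\partial_t$, $T=\partial_t$, with the Riemannian metric making $X,Y,T$ orthonormal (its volume is Lebesgue measure). For a measurable set $E$ and an open set $\Omega$, the perimeter $|\partial E|(\Omega)\in[0,\infty]$ is the supremum of $\int_{E\cap\Omega}\operatorname{div}U$ over horizontal $C^1$ vector fields $U$ (i.e. $U(p)\in\operatorname{span}(X_p,Y_p)$ for all $p$) with $|U|\le1$ and compact support contained in $\Omega$. The set $E$ has locally finite perimeter if $|\partial E|(\Omega)<\infty$ for every bounded open $\Omega$. It is area-minimizing if it has locally finite perimeter and, for every open set $\Omega$ and every measurable set $F$ such that $E\triangle F$ is contained in a compact subset of $\Omega$, $|\partial E|(\Omega)\le|\partial F|(\Omega)$. Let $\beta\in C^k(\mathbb R)$, $2\le k\le\infty$, be non-decreasing, and let $\alpha=\cot^{-1}\beta:\mathbb R\to(0,\pi)$. For $v\in\mathbb R$ let $\Gamma(v)=(v,0,0)$ and let $L_v^{\pm}=\{\Gamma(v)+s(\cos\alpha(v)\,X_{\Gamma(v)}\pm\sin\alpha(v)\,Y_{\Gamma(v)}):s\ge0\}$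 be the two horizontal halflines leaving $\Gamma(v)$ with angles $\pm\alpha(v)$. Let $\Sigma_\beta=\bigcup_{v}(L_v^+\cup L_v^-)$. Then $\Sigma_\beta$ is the graph $t=u_\beta(x,y)$ of a function $u_\beta:\mathbb R^2\to\mathbb R$, for each $(x,y)$ there is exactly one $v=:\xi_\beta(x,y)$ with $(x,y,u_\beta(x,y))\in L_v^+\cup L_v^-$, and: 1. $u_\beta$ is of class $C^k$ on $\{(x,y):y\ne0\}$. 2. $u_\beta$ is of class $C^{1,1}_{\mathrm{loc}}$ on $\mathbb R^2$, in particular near the $x$-axis: it is $C^1$ and its differential is locally Lipschitz. For every $x\in\mathbb R$, the function $y\mapsto\partial_yu_\beta(x,y)$ has at $y=0$ the right derivative $2\beta(x)$ and the left derivative $-2\beta(x)$. Hence, if $\beta(x)\ne0$, $u_\beta$ is not $C^2$ in any neighbourhood of $(x,0)$. 3. If $\beta=0$ on an open set $I\subset\mathbb R$, then $\xi_\beta^{-1}(I)$ is open and $u_\beta$ is $C^\infty$ on it. 4. $\Sigma_\beta$ is area-minimizing, that is, the subgraph $\{(x,y,t):t<u_\beta(x,y)\}$ is area-minimizing. 5.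 The singular set of $\Sigma_\beta$, i.e. the set of points $p\in\Sigma_\beta$ at which the tangent plane of $\Sigma_\beta$ equals $\operatorname{span}(X_p,Y_p)$, projects to the $xy$-plane exactly onto the $x$-axis $\{y=0\}$. -/

import Mathlib

open Set MeasureTheory
open scoped ContDiff

namespace Heis

/-- The underlying space `ℝ³` of the Heisenberg group, with coordinates `(x, y, t)`. -/
abbrev H : Type := ℝ × ℝ × ℝ

/-- The left invariant vector field `X = ∂x + y ∂t`. -/
def X (p : H) : H := (1, 0, p.2.1)

/-- The left invariant vector field `Y = ∂y - x ∂t`. -/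
def Y (p : H) : H := (0, 1, -p.1)

/-- The horizontal plane at `p`, spanned by `X_p` and `Y_p`. -/
def horizontalPlane (p : H) : Submodule ℝ H := Submodule.span ℝ {X p, Y p}

/-- The norm of a tangent vector `V` at `p` for the left invariant Riemannian metric that makes
`X, Y, T = ∂t` orthonormal. One has `V = V_x X + V_y Y + (V_t - y V_x + x V_y) T`. -/
noncomputable def riemNorm (p V : H) : ℝ :=
  Real.sqrt (V.1 ^ 2 + V.2.1 ^ 2 + (V.2.2 - p.2.1 * V.1 + p.1 * V.2.1) ^ 2)

/-- The Riemannian divergence of a vector field. The Riemannian volume is Lebesgue measure on `ℝ³`,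
so this is the divergence in the coordinates `(x, y, t)`. -/
noncomputable def divergence (U : H → H) (p : H) : ℝ :=
  (fderiv ℝ U p (1, 0, 0)).1 + (fderiv ℝ U p (0, 1, 0)).2.1 + (fderiv ℝ U p (0, 0, 1)).2.2

/-- Horizontal `C¹` vector fields of norm at most one, with compact support inside `Ω`. -/
structure IsTestField (Ω : Set H) (U : H → H) : Prop where
  contDiff : ContDiff ℝ 1 U
  horizontal : ∀ p, U p ∈ horizontalPlane p
  norm_le : ∀ p, riemNorm p (U p) ≤ 1
  compact : HasCompactSupport U
  support_subset : tsupport U ⊆ Ω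

/-- The sub-Riemannian perimeter `|∂E|(Ω)` of `E` in the open set `Ω`. -/
noncomputable def perimeter (E Ω : Set H) : ENNReal :=
  ⨆ (U : H → H) (_ : IsTestField Ω U), ENNReal.ofReal (∫ p in E ∩ Ω, divergence U p)

/-- (Lebesgue measurable) sets of locally finite perimeter. -/
def LocallyFinitePerimeter (E : Set H) : Prop :=
  NullMeasurableSet E ∧
    ∀ Ω : Set H, IsOpen Ω → Bornology.IsBounded Ω → perimeter E Ω < ⊤

/-- `E` is area-minimizing in the open set `Ω`: it has locally finite perimeter, and its perimeter
in `Ω` is at most that of any measurable `F` that differs from `E` only inside a compact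
subset of `Ω`. -/
def AreaMinimizingIn (E Ω : Set H) : Prop :=
  LocallyFinitePerimeter E ∧
    ∀ F : Set H, NullMeasurableSet F →
      (∃ K : Set H, IsCompact K ∧ K ⊆ Ω ∧ symmDiff E F ⊆ K) →
        perimeter E Ω ≤ perimeter F Ω

/-- `E` is area-minimizing: it is so in every open set. -/
def AreaMinimizing (E : Set H) : Prop :=
  ∀ Ω : Set H, IsOpen Ω → AreaMinimizingIn E Ω

/-- The subgraph of a function on the `xy`-plane. -/
def subgraph (u : ℝ × ℝ → ℝ) : Set H := {p | p.2.2 < u (p.1, p.2.1)}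

/-- The singular set of a `C¹` surface `S`: the points of `S` at which the tangent plane is the
horizontal plane. (The tangent cone to a `C¹` surface at one of its points is its tangent
plane.) -/
def singularSet (S : Set H) : Set H :=
  {p ∈ S | tangentConeAt ℝ S p = (horizontalPlane p : Set H)}

/-- The projection to the `xy`-plane. -/
def proj (p : H) : ℝ × ℝ := (p.1, p.2.1)

/-- The angle `α(v) = arccot (β v) ∈ (0, π)`. -/
noncomputable def angle (β : ℝ → ℝ) (v : ℝ) : ℝ := Real.pi / 2 - Real.arctan (β v)

/-- The point `Γ(v)` of the `x`-axis. -/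
def axisPoint (v : ℝ) : H := (v, 0, 0)

/-- The union of the two closed horizontal halflines that leave `Γ(v)` with angles `α(v)` and
`-α(v)`. -/
def halflines (β : ℝ → ℝ) (v : ℝ) : Set H :=
  {p | ∃ s : ℝ, 0 ≤ s ∧
    (p = axisPoint v + s • (Real.cos (angle β v) • X (axisPoint v)
          + Real.sin (angle β v) • Y (axisPoint v)) ∨
     p = axisPoint v + s • (Real.cos (angle β v) • X (axisPoint v)
          - Real.sin (angle β v) • Y (axisPoint v)))}

/-- The surface `Σ_β`, the union of all these halflines. -/
def surface (β : ℝ → ℝ) : Set H := ⋃ v : ℝ, halflines β v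

/-- The function `u_β` whose graph is `Σ_β`: `u_β(x, y)` is the height `t` at which the vertical
line over `(x, y)` meets `Σ_β`. -/
noncomputable def height (β : ℝ → ℝ) (q : ℝ × ℝ) : ℝ :=
  Classical.epsilon fun t : ℝ => (q.1, q.2, t) ∈ surface β

/-- `ξ_β(x, y)` is the `v` such that `(x, y, u_β(x, y))` lies on one of the two halflines
leaving `Γ(v)`. -/
noncomputable def foot (β : ℝ → ℝ) (q : ℝ × ℝ) : ℝ :=
  Classical.epsilon fun v : ℝ => (q.1, q.2, height β q) ∈ halflines β v

end Heis

/-! Since sin α > 0 and cos α = β sin α, a point (x, y, t) lies on a halfline leaving Γ(v) exactly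
when v + |y| β(v) = x and t = -y v (`mem_halflines`). As β is monotone, v ↦ v + |y| β(v) is a
bijection of ℝ, so Σ_β is the graph of u = -y ξ with ξ the solution v. For y ≠ 0, regularity is the
inverse function theorem. With J = 1/(1 + |y| β'(ξ)), the differential is du = -y J dx + (-ξ + |y|
β(ξ) J) dy. It contains no sgn y: it is a C¹ expression in y, |y|, ξ, all locally Lipschitz. The
form u_y = -x + |y| β(ξ)(1 + J) shows the corner of u_y on the axis.

The horizontal normal of the graph is (1 + J)(y, -|y| β(ξ)), which vanishes exactly on y = 0; this
gives the singular set. Normalized and extended independently of t, it is the field (sgn y sin α(ξ),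
-cos α(ξ)), which may jump across y = 0. Replacing |y| by √(y² + ε²) throughout gives C¹ fields of
norm at most one that are still exactly divergence-free (`calib_divergence_eq_zero`) and tend to it
pointwise off the axis. Cut off, they are test fields for any competitor, and
`areaMinimizing_of_calibration` concludes through the divergence theorem below a C¹ graph. -/

open Filter Topology

namespace Heis

/-! ### The equation v + r β(v) = x for r ≥ 0. -/

section Surface

variable {β : ℝ → ℝ}

/-- For `r ≥ 0` and `β` continuous and non-decreasing, `axisFoot β (x, r)` is the unique solution
`v` of `v + r * β v = x`. -/
noncomputable def axisFoot (β : ℝ → ℝ) (q : ℝ × ℝ) : ℝ :=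
  Classical.epsilon fun v : ℝ => v + q.2 * β v = q.1

theorem exists_add_mul_eq (hc : Continuous β) (hm : Monotone β) {r : ℝ} (hr : 0 ≤ r) (x : ℝ) :
    ∃ v, v + r * β v = x := by
  have hcont : Continuous fun v => v + r * β v := by fun_prop
  have hs : Function.Surjective fun v => v + r * β v := by
    refine hcont.surjective ?_ ?_
    · refine tendsto_atTop_mono' atTop (f₁ := fun v => v + r * β 0) ?_
        (tendsto_atTop_add_const_right _ _ tendsto_id)
      filter_upwards [eventually_ge_atTop 0] with v hv
      have := mul_le_mul_of_nonneg_left (hm hv) hr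
      linarith
    · refine tendsto_atBot_mono' atBot (f₂ := fun v => v + r * β v)
        (f₁ := fun v => v + r * β 0) ?_ (tendsto_atBot_add_const_right _ _ tendsto_id)
      filter_upwards [eventually_le_atBot 0] with v hv
      have := mul_le_mul_of_nonneg_left (hm hv) hr
      linarith
  exact hs x

theorem axisFoot_spec (hc : Continuous β) (hm : Monotone β) {q : ℝ × ℝ} (hr : 0 ≤ q.2) :
    axisFoot β q + q.2 * β (axisFoot β q) = q.1 :=
  Classical.epsilon_spec (exists_add_mul_eq hc hm hr q.1)

/-- By monotonicity v - v' and r (β v - β v') have the same sign, so adding the second to the first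
cannot decrease its absolute value. This single estimate yields uniqueness, continuity up to r = 0
and the Lipschitz bound, without differentiating β. -/
theorem abs_sub_le_of_add_mul_eq (hm : Monotone β) {v v' x x' r r' : ℝ} (hr : 0 ≤ r)
    (h : v + r * β v = x) (h' : v' + r' * β v' = x') :
    |v - v'| ≤ |x - x'| + |r - r'| * |β v'| := by
  have key : |v - v'| ≤ |(v - v') + r * (β v - β v')| := by
    rcases le_total v' v with hv | hv
    · have := mul_nonneg hr (sub_nonneg.2 (hm hv))
      rw [abs_of_nonneg (sub_nonneg.2 hv)]
      exact le_trans (by linarith) (le_abs_self _)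
    · have := mul_nonneg hr (sub_nonneg.2 (hm hv))
      rw [abs_of_nonpos (sub_nonpos.2 hv)]
      exact le_trans (by linarith) (neg_le_abs _)
  have e : (v - v') + r * (β v - β v') = (x - x') - (r - r') * β v' := by
    rw [← h, ← h']; ring
  rw [e] at key
  refine key.trans ((abs_sub _ _).trans ?_)
  rw [abs_mul]

theorem eq_axisFoot_iff (hc : Continuous β) (hm : Monotone β) {q : ℝ × ℝ} (hr : 0 ≤ q.2) {v : ℝ} :
    v = axisFoot β q ↔ v + q.2 * β v = q.1 := by
  refine ⟨fun h => h ▸ axisFoot_spec hc hm hr, fun h => ?_⟩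
  have := abs_sub_le_of_add_mul_eq hm hr h (axisFoot_spec hc hm hr)
  simp only [sub_self, abs_zero, zero_mul, add_zero] at this
  linarith [abs_nonpos_iff.1 this]

theorem abs_axisFoot_sub_le (hc : Continuous β) (hm : Monotone β) {q q' : ℝ × ℝ} (hr : 0 ≤ q.2)
    (hr' : 0 ≤ q'.2) :
    |axisFoot β q - axisFoot β q'| ≤ |q.1 - q'.1| + |q.2 - q'.2| * |β (axisFoot β q')| :=
  abs_sub_le_of_add_mul_eq hm hr (axisFoot_spec hc hm hr) (axisFoot_spec hc hm hr')

theorem continuousOn_axisFoot (hc : Continuous β) (hm : Monotone β) :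
    ContinuousOn (axisFoot β) {q | 0 ≤ q.2} := by
  intro q hq
  have h0 : Tendsto (fun p : ℝ × ℝ => |p.1 - q.1| + |p.2 - q.2| * |β (axisFoot β q)|) (𝓝 q)
      (𝓝 0) := by
    have : Continuous fun p : ℝ × ℝ => |p.1 - q.1| + |p.2 - q.2| * |β (axisFoot β q)| := by
      fun_prop
    simpa using this.tendsto q
  refine tendsto_iff_dist_tendsto_zero.2
    (squeeze_zero' (Eventually.of_forall fun _ => dist_nonneg) ?_
      (h0.mono_left nhdsWithin_le_nhds))
  filter_upwards [self_mem_nhdsWithin] with p hp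
  exact abs_axisFoot_sub_le hc hm hp hq

/-- Inverse function theorem for (v, r) ↦ (v + r β(v), r), whose Jacobian 1 + r β'(v) is at least 1.
-/
theorem contDiffAt_axisFoot {n : WithTop ℕ∞} (hn : n ≠ 0) (hβ : ContDiff ℝ n β) (hm : Monotone β)
    {q : ℝ × ℝ} (hq : 0 < q.2) : ContDiffAt ℝ n (axisFoot β) q := by
  have hc := hβ.continuous
  set v := axisFoot β q with hv
  have hvq : v + q.2 * β v = q.1 := axisFoot_spec hc hm hq.le
  let f : ℝ × ℝ → ℝ × ℝ := fun p => (p.1 + p.2 * β p.1, p.2)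
  have hf : ContDiff ℝ n f := by
    refine ContDiff.prodMk ?_ contDiff_snd
    exact contDiff_fst.add (contDiff_snd.mul (hβ.comp contDiff_fst))
  have hd : HasDerivAt β (deriv β v) v := (hβ.differentiable hn v).hasDerivAt
  have hJ : 0 < 1 + q.2 * deriv β v := by
    have := mul_nonneg hq.le (hm.deriv_nonneg (x := v))
    linarith
  let e : (ℝ × ℝ) ≃L[ℝ] (ℝ × ℝ) := ContinuousLinearEquiv.equivOfInverse
    (((1 + q.2 * deriv β v) • ContinuousLinearMap.fst ℝ ℝ ℝ +
      β v • ContinuousLinearMap.snd ℝ ℝ ℝ).prod (ContinuousLinearMap.snd ℝ ℝ ℝ))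
    (((1 + q.2 * deriv β v)⁻¹ • (ContinuousLinearMap.fst ℝ ℝ ℝ -
      β v • ContinuousLinearMap.snd ℝ ℝ ℝ)).prod (ContinuousLinearMap.snd ℝ ℝ ℝ))
    (by intro p; ext <;> simp; field_simp) (by intro p; ext <;> simp; field_simp; ring)
  have he : HasFDerivAt f (e : ℝ × ℝ →L[ℝ] ℝ × ℝ) (v, q.2) := by
    have h1 : HasFDerivAt (fun p : ℝ × ℝ => β p.1) (deriv β v • ContinuousLinearMap.fst ℝ ℝ ℝ)
        (v, q.2) := HasDerivAt.comp_hasFDerivAt (v, q.2) hd hasFDerivAt_fst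
    have h2 := (hasFDerivAt_fst (𝕜 := ℝ) (p := ((v, q.2) : ℝ × ℝ))).add
      ((hasFDerivAt_snd (𝕜 := ℝ) (p := ((v, q.2) : ℝ × ℝ))).mul h1)
    refine HasFDerivAt.prodMk (h2.congr_fderiv ?_) hasFDerivAt_snd
    ext <;> simp
  have hfa : ContDiffAt ℝ n f (v, q.2) := hf.contDiffAt
  have hfq : f (v, q.2) = q := Prod.ext hvq rfl
  have hL := hfa.to_localInverse he hn
  have hR := (hfa.hasStrictFDerivAt' he hn).eventually_right_inverse
  rw [hfq] at hL hR
  refine (contDiffAt_fst.comp q hL).congr_of_eventuallyEq ?_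
  -- Near q the second coordinate stays positive, so uniqueness identifies the local inverse with
  -- `axisFoot`.
  have hpos : ∀ᶠ p : ℝ × ℝ in 𝓝 q, 0 < p.2 := continuous_snd.continuousAt.eventually_const_lt hq
  filter_upwards [hR, hpos] with p hp hp2
  symm
  refine (eq_axisFoot_iff hc hm hp2.le).2 ?_
  have h1 := congrArg Prod.fst hp
  have h2 := congrArg Prod.snd hp
  simp only [f] at h1 h2
  rw [← h2]
  exact h1

/-- Differentiability being known, the identity v + r β(v) = x is differentiated and solved for dv.
-/
theorem hasFDerivAt_axisFoot (hβ : ContDiff ℝ 1 β) (hm : Monotone β) {q : ℝ × ℝ} (hq : 0 < q.2) :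
    HasFDerivAt (axisFoot β) ((1 + q.2 * deriv β (axisFoot β q))⁻¹ •
      (ContinuousLinearMap.fst ℝ ℝ ℝ - β (axisFoot β q) • ContinuousLinearMap.snd ℝ ℝ ℝ)) q := by
  have hc := hβ.continuous
  have hD := ((contDiffAt_axisFoot one_ne_zero hβ hm hq).differentiableAt one_ne_zero).hasFDerivAt
  set D := fderiv ℝ (axisFoot β) q
  set v := axisFoot β q with hv
  have hd : HasDerivAt β (deriv β v) v := (hβ.differentiable one_ne_zero v).hasDerivAt
  have hJ : 0 < 1 + q.2 * deriv β v := by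
    have := mul_nonneg hq.le (hm.deriv_nonneg (x := v))
    linarith
  have h1 := hD.add ((hasFDerivAt_snd (𝕜 := ℝ) (p := q)).mul (hd.comp_hasFDerivAt q hD))
  have hpos : ∀ᶠ p : ℝ × ℝ in 𝓝 q, 0 < p.2 := continuous_snd.continuousAt.eventually_const_lt hq
  have h2 := (hasFDerivAt_fst (𝕜 := ℝ) (p := q)).congr_of_eventuallyEq
    (hpos.mono fun p hp => axisFoot_spec hc hm hp.le)
  have h3 := h1.unique h2
  refine hD.congr_fderiv ?_
  ext
  · have := DFunLike.congr_fun h3 ((1, 0) : ℝ × ℝ)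
    simp at this ⊢
    rw [← hv] at *
    field_simp
    linarith
  · have := DFunLike.congr_fun h3 ((0, 1) : ℝ × ℝ)
    simp at this ⊢
    rw [← hv] at *
    field_simp
    linarith

/-! ### The union of the halflines as a graph. -/

theorem cos_angle (β : ℝ → ℝ) (v : ℝ) :
    Real.cos (angle β v) = β v * Real.sin (angle β v) := by
  rw [angle, Real.cos_pi_div_two_sub, Real.sin_pi_div_two_sub, Real.sin_arctan, Real.cos_arctan]
  ring

theorem sin_angle_pos (β : ℝ → ℝ) (v : ℝ) : 0 < Real.sin (angle β v) := by
  rw [angle, Real.sin_pi_div_two_sub]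
  exact Real.cos_arctan_pos _

/-- On both halflines |y| = s sin α, hence s cos α = |y| β(v): the parameter and the angle
disappear, and the sign choice survives only as the sign of y. -/
theorem mem_halflines {x y t v : ℝ} :
    (x, y, t) ∈ halflines β v ↔ v + |y| * β v = x ∧ t = -(y * v) := by
  have hs := sin_angle_pos β v
  simp only [halflines, mem_ofPred_eq, cos_angle, axisPoint, X, Y, Prod.smul_mk, smul_eq_mul,
    Prod.mk_add_mk, Prod.mk_sub_mk, Prod.mk.injEq]
  set σ := Real.sin (angle β v)
  constructor
  · rintro ⟨s, hs0, ⟨h1, h2, h3⟩ | ⟨h1, h2, h3⟩⟩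
    · have hy : y = s * σ := by rw [h2]; ring
      have : |y| = s * σ := by rw [hy, abs_of_nonneg (by positivity)]
      refine ⟨by rw [this, h1]; ring, by rw [h3, hy]; ring⟩
    · have hy : y = -(s * σ) := by rw [h2]; ring
      have : |y| = s * σ := by rw [hy, abs_neg, abs_of_nonneg (by positivity)]
      refine ⟨by rw [this, h1]; ring, by rw [h3, hy]; ring⟩
  · rintro ⟨h1, h2⟩
    refine ⟨|y| / σ, by positivity, ?_⟩
    rcases le_total 0 y with hy | hy
    · left
      rw [abs_of_nonneg hy] at *
      refine ⟨?_, ?_, ?_⟩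
      · rw [← h1]; field_simp; ring
      · field_simp; ring
      · rw [h2]; field_simp; ring
    · right
      rw [abs_of_nonpos hy] at *
      refine ⟨?_, ?_, ?_⟩
      · rw [← h1]; field_simp; ring
      · field_simp; ring
      · rw [h2]; field_simp; ring

theorem mem_surface (hc : Continuous β) (hm : Monotone β) {x y t : ℝ} :
    (x, y, t) ∈ surface β ↔ t = -(y * axisFoot β (x, |y|)) := by
  simp only [surface, mem_iUnion, mem_halflines]
  constructor
  · rintro ⟨v, h1, h2⟩
    rw [h2, (eq_axisFoot_iff hc hm (q := (x, |y|)) (abs_nonneg y)).2 h1]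
  · intro h
    exact ⟨_, axisFoot_spec hc hm (q := (x, |y|)) (abs_nonneg y), h⟩

theorem height_eq (hc : Continuous β) (hm : Monotone β) (q : ℝ × ℝ) :
    height β q = -(q.2 * axisFoot β (q.1, |q.2|)) := by
  have : (q.1, q.2, height β q) ∈ surface β :=
    Classical.epsilon_spec (p := fun t : ℝ => (q.1, q.2, t) ∈ surface β)
      ⟨_, (mem_surface hc hm).2 rfl⟩
  exact (mem_surface hc hm).1 this

theorem mem_surface_iff_eq_height (hc : Continuous β) (hm : Monotone β) {x y t : ℝ} :
    (x, y, t) ∈ surface β ↔ t = height β (x, y) := by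
  rw [mem_surface hc hm, height_eq hc hm]

theorem mem_halflines_height (hc : Continuous β) (hm : Monotone β) {x y v : ℝ} :
    (x, y, height β (x, y)) ∈ halflines β v ↔ v = axisFoot β (x, |y|) := by
  rw [mem_halflines, height_eq hc hm, eq_axisFoot_iff hc hm (q := (x, |y|)) (abs_nonneg y)]
  refine ⟨fun h => h.1, fun h => ⟨h, ?_⟩⟩
  rw [(eq_axisFoot_iff hc hm (q := (x, |y|)) (abs_nonneg y)).2 h]

theorem foot_eq (hc : Continuous β) (hm : Monotone β) (q : ℝ × ℝ) :
    foot β q = axisFoot β (q.1, |q.2|) := by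
  have : (q.1, q.2, height β q) ∈ halflines β (foot β q) :=
    Classical.epsilon_spec (p := fun v : ℝ => (q.1, q.2, height β q) ∈ halflines β v)
      ⟨_, (mem_halflines_height hc hm).2 rfl⟩
  exact (mem_halflines_height hc hm).1 this

theorem height_eq_foot (hc : Continuous β) (hm : Monotone β) (q : ℝ × ℝ) :
    height β q = -(q.2 * foot β q) := by
  rw [height_eq hc hm, foot_eq hc hm]

theorem foot_spec (hc : Continuous β) (hm : Monotone β) (q : ℝ × ℝ) :
    foot β q + |q.2| * β (foot β q) = q.1 := by
  rw [foot_eq hc hm]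
  exact axisFoot_spec hc hm (q := (q.1, |q.2|)) (abs_nonneg _)

theorem foot_axis (hc : Continuous β) (hm : Monotone β) (x : ℝ) : foot β (x, 0) = x := by
  have := foot_spec hc hm (x, 0)
  simpa using this

/-! ### Regularity of ξ_β and u_β. -/

theorem continuous_foot (hc : Continuous β) (hm : Monotone β) : Continuous (foot β) := by
  have h : foot β = fun q : ℝ × ℝ => axisFoot β (q.1, |q.2|) := funext (foot_eq hc hm)
  rw [h]
  exact (continuousOn_axisFoot hc hm).comp_continuous (by fun_prop) fun q => abs_nonneg q.2

theorem locallyLipschitz_foot (hc : Continuous β) (hm : Monotone β) :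
    LocallyLipschitz (foot β) := by
  intro q
  obtain ⟨M, hM⟩ : ∃ M : ℝ, |β (foot β q)| < M := exists_gt _
  have hM0 : 0 ≤ M := (abs_nonneg _).trans hM.le
  have hcf := continuous_foot hc hm
  have hev : ∀ᶠ p in 𝓝 q, |β (foot β p)| < M :=
    (by fun_prop : Continuous fun p => |β (foot β p)|).continuousAt.eventually_lt_const hM
  -- The 1 bounds the change in x; M, a local bound for |β(ξ)|, multiplies the change in |y|.
  refine ⟨⟨1 + M, by positivity⟩, _, hev, LipschitzOnWith.of_dist_le_mul fun p _ p' hp' => ?_⟩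
  have h := abs_sub_le_of_add_mul_eq hm (abs_nonneg p.2) (foot_spec hc hm p) (foot_spec hc hm p')
  have h1 : |p.1 - p'.1| ≤ dist p p' := by
    rw [← Real.dist_eq]; exact le_max_left _ _
  have h2 : |(|p.2| - |p'.2|)| ≤ dist p p' := by
    refine (abs_abs_sub_abs_le_abs_sub _ _).trans ?_
    rw [← Real.dist_eq]; exact le_max_right _ _
  calc dist (foot β p) (foot β p') = |foot β p - foot β p'| := Real.dist_eq _ _
    _ ≤ dist p p' + dist p p' * M :=
      h.trans (add_le_add h1 (mul_le_mul h2 (le_of_lt hp') (abs_nonneg _) dist_nonneg))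
    _ = (1 + M) * dist p p' := by ring

theorem contDiffAt_foot {n : ℕ∞} (hn : n ≠ 0) (hβ : ContDiff ℝ (n : WithTop ℕ∞) β)
    (hm : Monotone β) {q : ℝ × ℝ} (hq : q.2 ≠ 0) :
    ContDiffAt ℝ (n : WithTop ℕ∞) (foot β) q := by
  have h : foot β = fun q : ℝ × ℝ => axisFoot β (q.1, |q.2|) := funext (foot_eq hβ.continuous hm)
  rw [h]
  refine ContDiffAt.comp q (g := axisFoot β) (f := fun q : ℝ × ℝ => (q.1, |q.2|))
    (contDiffAt_axisFoot (by exact_mod_cast hn) hβ hm (abs_pos.2 hq)) ?_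
  exact contDiffAt_fst.prodMk (contDiffAt_snd.abs hq)

/-- The factor `1 / (1 + |y| β'(ξ))`, the `x`-derivative of `ξ_β`. -/
noncomputable def footSlope (β : ℝ → ℝ) (q : ℝ × ℝ) : ℝ :=
  (1 + |q.2| * deriv β (foot β q))⁻¹

theorem one_le_footSlope_inv (hm : Monotone β) (q : ℝ × ℝ) :
    1 ≤ 1 + |q.2| * deriv β (foot β q) := by
  have := mul_nonneg (abs_nonneg q.2) (hm.deriv_nonneg (x := foot β q))
  linarith

theorem footSlope_pos (hm : Monotone β) (q : ℝ × ℝ) : 0 < footSlope β q :=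
  inv_pos.2 (one_pos.trans_le (one_le_footSlope_inv hm q))

/-- The differential of `u_β`. -/
noncomputable def heightDeriv (β : ℝ → ℝ) (q : ℝ × ℝ) : ℝ × ℝ →L[ℝ] ℝ :=
  (-(q.2 * footSlope β q)) • ContinuousLinearMap.fst ℝ ℝ ℝ +
    (-foot β q + |q.2| * β (foot β q) * footSlope β q) • ContinuousLinearMap.snd ℝ ℝ ℝ

/-- Off the axis this is the product rule, with y sgn y = |y|. On the axis ξ need not be
differentiable, but u + x₀ y = -y (ξ - x₀) is o(|y|) at (x₀, 0) because ξ is continuous. -/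
theorem hasFDerivAt_height (hβ : ContDiff ℝ 1 β) (hm : Monotone β) (q : ℝ × ℝ) :
    HasFDerivAt (height β) (heightDeriv β q) q := by
  have hc := hβ.continuous
  rcases eq_or_ne q.2 0 with hq | hq
  · obtain ⟨x, y⟩ := q
    simp only at hq
    subst hq
    have hfun : height β = fun q => -(q.2 * foot β q) := funext (height_eq_foot hc hm)
    rw [hfun, hasFDerivAt_iff_isLittleO]
    have hlim : Tendsto (fun p : ℝ × ℝ => foot β p - x) (𝓝 (x, 0)) (𝓝 0) := by
      have := ((continuous_foot hc hm).sub continuous_const).tendsto (x := ((x, 0) : ℝ × ℝ))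
        (f := fun p => foot β p - x)
      simpa [foot_axis hc hm] using this
    have h1 : (fun p : ℝ × ℝ => p.2 * (foot β p - x)) =o[𝓝 (x, 0)]
        fun p : ℝ × ℝ => p.2 * 1 :=
      (Asymptotics.isBigO_refl _ _).mul_isLittleO ((Asymptotics.isLittleO_one_iff ℝ).2 hlim)
    have h2 : (fun p : ℝ × ℝ => p.2 * 1) =O[𝓝 (x, 0)] fun p => p - (x, 0) := by
      refine Asymptotics.IsBigO.of_bound 1 (Eventually.of_forall fun p => ?_)
      have := norm_snd_le (p - (x, 0))
      rw [Prod.snd_sub, sub_zero] at this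
      simpa using this
    refine ((h1.trans_isBigO h2).neg_left).congr_left fun p => ?_
    simp [heightDeriv, foot_axis hc hm]
    ring
  · have ha : HasDerivAt (fun y : ℝ => |y|) (SignType.sign q.2 : ℝ) q.2 := hasDerivAt_abs hq
    have h1 : HasFDerivAt (fun p : ℝ × ℝ => (p.1, |p.2|)) ((ContinuousLinearMap.fst ℝ ℝ ℝ).prod
        ((SignType.sign q.2 : ℝ) • ContinuousLinearMap.snd ℝ ℝ ℝ)) q :=
      hasFDerivAt_fst.prodMk (ha.comp_hasFDerivAt q hasFDerivAt_snd)
    have h2 := (hasFDerivAt_axisFoot hβ hm (q := (q.1, |q.2|)) (abs_pos.2 hq)).comp q h1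
    have h3 := ((hasFDerivAt_snd (𝕜 := ℝ) (p := q)).mul h2).neg
    have hfun : height β = fun q => -(q.2 * axisFoot β (q.1, |q.2|)) := funext (height_eq hc hm)
    rw [hfun]
    refine h3.congr_fderiv ?_
    have hs : |q.2| = q.2 * (SignType.sign q.2 : ℝ) := (self_mul_sign q.2).symm
    ext
    · simp [heightDeriv, footSlope, foot_eq hc hm]
    · simp [heightDeriv, footSlope, foot_eq hc hm]
      generalize (1 + |q.2| * deriv β (axisFoot β (q.1, |q.2|)))⁻¹ = J
      generalize axisFoot β (q.1, |q.2|) = v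
      rw [hs]
      ring

theorem fderiv_height (hβ : ContDiff ℝ 1 β) (hm : Monotone β) :
    fderiv ℝ (height β) = heightDeriv β :=
  funext fun q => (hasFDerivAt_height hβ hm q).fderiv

theorem contDiff_one_deriv (hβ : ContDiff ℝ 2 β) : ContDiff ℝ 1 (deriv β) := by
  have : ContDiff ℝ (1 + 1) β := hβ.of_le (by norm_num)
  exact (contDiff_succ_iff_deriv.1 this).2.2

/-- Smoothness of R is asked only at values of f: the denominator 1 + r β'(v) used below may vanish
for r < 0, which |y| never reaches. -/
theorem locallyLipschitz_comp_of_contDiffAt {α E F : Type*} [PseudoEMetricSpace α]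
    [NormedAddCommGroup E] [NormedSpace ℝ E] [NormedAddCommGroup F] [NormedSpace ℝ F] {f : α → E}
    (hf : LocallyLipschitz f) {R : E → F} (hR : ∀ a, ContDiffAt ℝ 1 R (f a)) :
    LocallyLipschitz fun a => R (f a) := by
  intro a
  obtain ⟨K, s, hs, hK⟩ := (hR a).exists_lipschitzOnWith
  obtain ⟨L, t, ht, hL⟩ := hf a
  refine ⟨K * L, t ∩ f ⁻¹' s, inter_mem ht (hf.continuous.continuousAt hs), ?_⟩
  exact hK.comp (hL.mono inter_subset_left) fun p hp => hp.2

theorem locallyLipschitz_heightDeriv (hβ : ContDiff ℝ 2 β) (hm : Monotone β) :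
    LocallyLipschitz (heightDeriv β) := by
  have hf := locallyLipschitz_foot hβ.continuous hm
  have hd := contDiff_one_deriv hβ
  have hβ1 : ContDiff ℝ 1 β := hβ.of_le (by norm_num)
  have habs : LocallyLipschitz fun q : ℝ × ℝ => |q.2| := by
    have : LipschitzWith 1 fun y : ℝ => |y| := lipschitzWith_one_norm
    exact (this.comp LipschitzWith.prod_snd).locallyLipschitz
  have hin : LocallyLipschitz fun q : ℝ × ℝ => (q.2, |q.2|, foot β q) :=
    LipschitzWith.prod_snd.locallyLipschitz.prodMk (habs.prodMk hf)
  have hinv (q : ℝ × ℝ) : ContDiffAt ℝ 1 (fun p : ℝ × ℝ × ℝ => (1 + p.2.1 * deriv β p.2.2)⁻¹)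
      (q.2, |q.2|, foot β q) :=
    (by fun_prop : ContDiff ℝ 1 fun p : ℝ × ℝ × ℝ => 1 + p.2.1 * deriv β p.2.2).contDiffAt.inv
      (one_pos.trans_le (one_le_footSlope_inv hm q)).ne'
  have h1 : LocallyLipschitz fun q : ℝ × ℝ => -(q.2 * footSlope β q) :=
    locallyLipschitz_comp_of_contDiffAt hin
      (R := fun p : ℝ × ℝ × ℝ => -(p.1 * (1 + p.2.1 * deriv β p.2.2)⁻¹))
      fun q => (contDiffAt_fst.mul (hinv q)).neg
  have h2 : LocallyLipschitz fun q : ℝ × ℝ =>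
      -foot β q + |q.2| * β (foot β q) * footSlope β q :=
    locallyLipschitz_comp_of_contDiffAt hin
      (R := fun p : ℝ × ℝ × ℝ => -p.2.2 + p.2.1 * β p.2.2 * (1 + p.2.1 * deriv β p.2.2)⁻¹)
      fun q => contDiff_snd.snd.neg.contDiffAt.add (ContDiffAt.mul
        (by fun_prop : ContDiff ℝ 1 fun p : ℝ × ℝ × ℝ => p.2.1 * β p.2.2).contDiffAt (hinv q))
  have hL : ContDiff ℝ 1 fun p : ℝ × ℝ =>
      p.1 • ContinuousLinearMap.fst ℝ ℝ ℝ + p.2 • ContinuousLinearMap.snd ℝ ℝ ℝ := by fun_prop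
  have hL' := hL.locallyLipschitz
  have h3 := hL'.comp (h1.prodMk h2)
  have e : heightDeriv β = (fun p : ℝ × ℝ =>
      p.1 • ContinuousLinearMap.fst ℝ ℝ ℝ + p.2 • ContinuousLinearMap.snd ℝ ℝ ℝ) ∘ fun q =>
        (-(q.2 * footSlope β q), -foot β q + |q.2| * β (foot β q) * footSlope β q) := rfl
  rw [e]
  exact h3

theorem continuous_heightDeriv (hβ : ContDiff ℝ 2 β) (hm : Monotone β) :
    Continuous (heightDeriv β) :=
  (locallyLipschitz_heightDeriv hβ hm).continuous

theorem contDiff_height (hβ : ContDiff ℝ 2 β) (hm : Monotone β) : ContDiff ℝ 1 (height β) := by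
  have hβ1 : ContDiff ℝ 1 β := hβ.of_le (by norm_num)
  rw [contDiff_one_iff_fderiv, fderiv_height hβ1 hm]
  exact ⟨fun q => (hasFDerivAt_height hβ1 hm q).differentiableAt, continuous_heightDeriv hβ hm⟩

theorem contDiffOn_height {n : ℕ∞} (hn : n ≠ 0) (hβ : ContDiff ℝ (n : WithTop ℕ∞) β)
    (hm : Monotone β) : ContDiffOn ℝ (n : WithTop ℕ∞) (height β) {q : ℝ × ℝ | q.2 ≠ 0} := by
  intro q hq
  have hfun : height β = fun q => -(q.2 * foot β q) := funext (height_eq_foot hβ.continuous hm)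
  rw [hfun]
  exact (contDiffAt_snd.mul (contDiffAt_foot hn hβ hm hq)).neg.contDiffWithinAt

/-! ### Second derivatives in y at the axis. -/

theorem deriv_height_snd (hβ : ContDiff ℝ 1 β) (hm : Monotone β) (x y : ℝ) :
    deriv (fun s : ℝ => height β (x, s)) y =
      -x + |y| * (β (foot β (x, y)) * (1 + footSlope β (x, y))) := by
  have h1 : HasDerivAt (fun s : ℝ => (x, s)) ((0, 1) : ℝ × ℝ) y :=
    (hasDerivAt_const y x).prodMk (hasDerivAt_id y)
  have h2 := (hasFDerivAt_height hβ hm (x, y)).comp_hasDerivAt y h1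
  have h3 := foot_spec hβ.continuous hm (x, y)
  simp only at h3
  refine h2.deriv.trans ?_
  simp [heightDeriv]
  linear_combination -h3

theorem continuous_footSlope (hβ : ContDiff ℝ 1 β) (hm : Monotone β) :
    Continuous (footSlope β) := by
  have h1 := hβ.continuous_deriv le_rfl
  have h2 := continuous_foot hβ.continuous hm
  refine Continuous.inv₀ (by fun_prop) fun q => (one_pos.trans_le (one_le_footSlope_inv hm q)).ne'

theorem hasDerivWithinAt_abs_mul {h : ℝ → ℝ} (hh : ContinuousAt h 0) (c : ℝ) :
    HasDerivWithinAt (fun y => c + |y| * h y) (h 0) (Ici 0) 0 ∧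
      HasDerivWithinAt (fun y => c + |y| * h y) (-h 0) (Iic 0) 0 := by
  -- The difference quotient of y h(y) at 0 is h(y), so continuity of h at 0 suffices.
  have key : HasDerivAt (fun y => y * h y) (h 0) 0 := by
    rw [hasDerivAt_iff_tendsto_slope]
    refine (hh.tendsto.mono_left nhdsWithin_le_nhds).congr' ?_
    filter_upwards [self_mem_nhdsWithin] with y hy
    have : y ≠ 0 := hy
    rw [slope_def_field]
    field_simp
    simp
  refine ⟨(key.const_add c).hasDerivWithinAt.congr (fun y hy => ?_) (by simp),
    (key.neg.const_add c).hasDerivWithinAt.congr (fun y hy => ?_) (by simp)⟩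
  · rw [abs_of_nonneg hy]
  · rw [abs_of_nonpos hy]; simp

theorem hasDerivWithinAt_deriv_height (hβ : ContDiff ℝ 1 β) (hm : Monotone β) (x : ℝ) :
    HasDerivWithinAt (fun y : ℝ => deriv (fun s : ℝ => height β (x, s)) y) (2 * β x) (Ici 0) 0 ∧
      HasDerivWithinAt (fun y : ℝ => deriv (fun s : ℝ => height β (x, s)) y)
        (-(2 * β x)) (Iic 0) 0 := by
  have h1 := continuous_foot hβ.continuous hm
  have h2 := continuous_footSlope hβ hm
  have h3 := hβ.continuous
  have h4 : Continuous fun y => β (foot β (x, y)) * (1 + footSlope β (x, y)) := by fun_prop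
  have h5 := hasDerivWithinAt_abs_mul h4.continuousAt (-x)
  -- At y = 0 the slope J equals 1, whence the factor 2.
  have h6 : β (foot β (x, 0)) * (1 + footSlope β (x, 0)) = 2 * β x := by
    rw [foot_axis h3 hm, footSlope]; simp; ring
  simp only [h6] at h5
  simpa only [deriv_height_snd hβ hm] using h5

theorem not_contDiffAt_two_height (hβ : ContDiff ℝ 1 β) (hm : Monotone β) {x : ℝ} (hx : β x ≠ 0) :
    ¬ ContDiffAt ℝ 2 (height β) (x, 0) := by
  intro h
  have h1 : ContDiffAt ℝ 2 (fun s : ℝ => height β (x, s)) 0 :=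
    ContDiffAt.comp (0 : ℝ) (g := height β) (f := fun s : ℝ => (x, s)) h
      (contDiffAt_const.prodMk contDiffAt_id)
  have h2 : DifferentiableAt ℝ (deriv fun s : ℝ => height β (x, s)) 0 := by
    have h1' : ContDiffAt ℝ (1 + 1) (fun s : ℝ => height β (x, s)) 0 := h1.of_le (by norm_num)
    have h3 := ((h1'.fderiv_right le_rfl).differentiableAt one_ne_zero).clm_apply
      (differentiableAt_const (1 : ℝ))
    simpa only [fderiv_apply_one_eq_deriv] using h3
  obtain ⟨hr, hl⟩ := hasDerivWithinAt_deriv_height hβ hm x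
  have er := (uniqueDiffWithinAt_Ici (0 : ℝ)).eq_deriv _ hr h2.hasDerivAt.hasDerivWithinAt
  have el := (uniqueDiffWithinAt_Iic (0 : ℝ)).eq_deriv _ hl h2.hasDerivAt.hasDerivWithinAt
  exact hx (by linarith)

/-- Where β(ξ) = 0 the foot equation reads ξ = x, so u = -x y. -/
theorem contDiffOn_height_preimage (hc : Continuous β) (hm : Monotone β) {I : Set ℝ}
    (h0 : ∀ v ∈ I, β v = 0) {n : WithTop ℕ∞} : ContDiffOn ℝ n (height β) (foot β ⁻¹' I) := by
  have h : ContDiff ℝ n fun q : ℝ × ℝ => -(q.2 * q.1) := by fun_prop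
  refine h.contDiffOn.congr fun q hq => ?_
  have := foot_spec hc hm q
  rw [h0 _ hq, mul_zero, add_zero] at this
  rw [height_eq_foot hc hm, this]

/-! ### Tangent planes and the singular set. -/

theorem mem_horizontalPlane {p V : H} :
    V ∈ horizontalPlane p ↔ V.2.2 = p.2.1 * V.1 - p.1 * V.2.1 := by
  rw [horizontalPlane, Submodule.mem_span_pair]
  constructor
  · rintro ⟨a, b, rfl⟩
    simp [X, Y]
    ring
  · intro h
    refine ⟨V.1, V.2.1, ?_⟩
    ext
    · simp [X, Y]
    · simp [X, Y]
    · simp [X, Y, h]; ring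

/-- The tangent cone of a differentiable graph is the graph of the differential. -/
theorem mem_tangentConeAt_graph {u : ℝ × ℝ → ℝ} {S : Set H}
    (hS : ∀ x y t : ℝ, (x, y, t) ∈ S ↔ t = u (x, y)) {q : ℝ × ℝ} {D : ℝ × ℝ →L[ℝ] ℝ}
    (hD : HasFDerivAt u D q) {V : H} :
    V ∈ tangentConeAt ℝ S (q.1, q.2, u q) ↔ V.2.2 = D (V.1, V.2.1) := by
  constructor
  · intro hV
    let P : H →L[ℝ] ℝ × ℝ := (ContinuousLinearMap.fst ℝ ℝ (ℝ × ℝ)).prod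
      ((ContinuousLinearMap.fst ℝ ℝ ℝ).comp (ContinuousLinearMap.snd ℝ ℝ (ℝ × ℝ)))
    let τ : H →L[ℝ] ℝ := (ContinuousLinearMap.snd ℝ ℝ ℝ).comp (ContinuousLinearMap.snd ℝ ℝ (ℝ × ℝ))
    have h1 : HasFDerivWithinAt (fun p : H => u (P p)) (D.comp P) S (q.1, q.2, u q) :=
      (HasFDerivAt.comp (g := u) (q.1, q.2, u q) hD P.hasFDerivAt).hasFDerivWithinAt
    -- On S the height t and u ∘ P coincide; their differentials within S must then agree on the
    -- tangent cone.
    have h2 : HasFDerivWithinAt (fun p : H => u (P p)) τ S (q.1, q.2, u q) :=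
      τ.hasFDerivWithinAt.congr (fun p hp => ((hS p.1 p.2.1 p.2.2).1 hp).symm) rfl
    exact h2.unique_on h1 hV
  · intro hV
    have h1 : HasFDerivWithinAt (fun p : ℝ × ℝ => ((p.1, p.2, u p) : H))
        ((ContinuousLinearMap.fst ℝ ℝ ℝ).prod ((ContinuousLinearMap.snd ℝ ℝ ℝ).prod D)) univ q :=
      (hasFDerivAt_fst.prodMk (hasFDerivAt_snd.prodMk hD)).hasFDerivWithinAt
    have h2 := HasFDerivWithinAt.mapsTo_tangent_cone h1 
      (show ((V.1, V.2.1) : ℝ × ℝ) ∈ _ by simp)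
    have h3 : (fun p : ℝ × ℝ => ((p.1, p.2, u p) : H)) '' univ ⊆ S := by
      rintro _ ⟨p, -, rfl⟩
      exact (hS _ _ _).2 rfl
    have h4 := tangentConeAt_mono h3 h2
    convert h4 using 1
    ext
    · rfl
    · rfl
    · exact hV

theorem proj_singularSet_surface (hβ : ContDiff ℝ 1 β) (hm : Monotone β) :
    proj '' singularSet (surface β) = {q : ℝ × ℝ | q.2 = 0} := by
  have hc := hβ.continuous
  have hcone : ∀ q : ℝ × ℝ, ∀ V : H, V ∈ tangentConeAt ℝ (surface β) (q.1, q.2, height β q) ↔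
      V.2.2 = heightDeriv β q (V.1, V.2.1) := fun q V =>
    mem_tangentConeAt_graph (fun x y t => mem_surface_iff_eq_height hc hm)
      (hasFDerivAt_height hβ hm q)
  ext ⟨x, y⟩
  constructor
  · rintro ⟨⟨x', y', t⟩, ⟨hp, hT⟩, he⟩
    obtain ⟨rfl, rfl⟩ : x' = x ∧ y' = y := by simpa [proj] using he
    have ht := (mem_surface_iff_eq_height hc hm).1 hp
    subst ht
    -- Tangency of X alone forces y (1 + J) = 0, with J > 0.
    have h1 : ((1, 0, y') : H) ∈ tangentConeAt ℝ (surface β) (x', y', height β (x', y')) := by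
      rw [hT]
      exact mem_horizontalPlane.2 (by simp)
    have h2 := (hcone (x', y') _).1 h1
    simp [heightDeriv] at h2
    have h3 := footSlope_pos hm (x', y')
    have h4 : y' * (1 + footSlope β (x', y')) = 0 := by linarith
    exact (mul_eq_zero.1 h4).resolve_right (by positivity)
  · intro hy
    have hy : y = 0 := hy
    subst hy
    refine ⟨(x, 0, height β (x, 0)), ⟨(mem_surface_iff_eq_height hc hm).2 rfl, ?_⟩, rfl⟩
    ext V
    rw [hcone (x, 0), SetLike.mem_coe, mem_horizontalPlane]
    simp [heightDeriv, foot_axis hc hm]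

end Surface

/-! ### The divergence theorem below a C¹ graph. -/

section DivergenceTheorem

theorem integrable_indicator_of_hasCompactSupport {α : Type*} [TopologicalSpace α]
    [MeasurableSpace α] [BorelSpace α] {μ : Measure α} [IsFiniteMeasureOnCompacts μ] {f : α → ℝ}
    (hf : Continuous f) (hs : HasCompactSupport f) {S : Set α} (hS : MeasurableSet S) :
    Integrable (S.indicator f) μ :=
  (hf.integrable_of_hasCompactSupport hs).indicator hS

/-- The support of f ∘ i lies in the image under j of the support of f. For slices and graphs, j is
a projection. -/
theorem hasCompactSupport_comp_of_leftInverse {α α' γ : Type*} [TopologicalSpace α]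
    [TopologicalSpace α'] [T2Space α] [Zero γ] {f : α' → γ} (hf : HasCompactSupport f) {i : α → α'}
    {j : α' → α} (hj : Continuous j) (hji : ∀ a, j (i a) = a) :
    HasCompactSupport fun a => f (i a) := by
  refine HasCompactSupport.intro (hf.isCompact.image hj) fun a ha => ?_
  by_contra h
  exact ha ⟨i a, subset_tsupport _ h, hji a⟩

theorem integral_add_add {α : Type*} [MeasurableSpace α] {μ : Measure α} {f₁ f₂ f₃ : α → ℝ}
    (h₁ : Integrable f₁ μ) (h₂ : Integrable f₂ μ) (h₃ : Integrable f₃ μ) :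
    ∫ a, (f₁ a + f₂ a + f₃ a) ∂μ = ∫ a, f₁ a ∂μ + ∫ a, f₂ a ∂μ + ∫ a, f₃ a ∂μ := by
  have h₁₂ : Integrable (fun a => f₁ a + f₂ a) μ := h₁.add h₂
  rw [integral_add h₁₂ h₃, integral_add h₁ h₂]

variable {g : (ℝ × ℝ) × ℝ → ℝ} {u : ℝ × ℝ → ℝ}

theorem continuous_fderiv_apply_const (hg : ContDiff ℝ 1 g) (w : (ℝ × ℝ) × ℝ) :
    Continuous fun z => fderiv ℝ g z w :=
  (hg.continuous_fderiv one_ne_zero).clm_apply continuous_const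

theorem hasCompactSupport_fderiv_apply_const (hs : HasCompactSupport g) (w : (ℝ × ℝ) × ℝ) :
    HasCompactSupport fun z => fderiv ℝ g z w :=
  (hs.fderiv ℝ).comp_left (g := fun L : (ℝ × ℝ) × ℝ →L[ℝ] ℝ => L w) (by simp)

/-- The fundamental theorem of calculus on the vertical lines below a graph. -/
theorem integral_below_graph_vertical (hg : ContDiff ℝ 1 g) (hs : HasCompactSupport g)
    (hu : Continuous u) {h : ℝ × ℝ → ℝ} (hh : Continuous h) :
    ∫ z in {z : (ℝ × ℝ) × ℝ | z.2 < u z.1}, h z.1 * fderiv ℝ g z (0, 1) =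
      ∫ q, h q * g (q, u q) := by
  have hS : MeasurableSet {z : (ℝ × ℝ) × ℝ | z.2 < u z.1} :=
    (isOpen_lt continuous_snd (hu.comp continuous_fst)).measurableSet
  have hF1 := continuous_fderiv_apply_const hg (0, 1)
  have hF2 : Continuous fun z : (ℝ × ℝ) × ℝ => h z.1 * fderiv ℝ g z (0, 1) := by fun_prop
  have hF3 : HasCompactSupport fun z : (ℝ × ℝ) × ℝ => h z.1 * fderiv ℝ g z (0, 1) :=
    HasCompactSupport.mul_left (hasCompactSupport_fderiv_apply_const hs (0, 1))
  have hint := integrable_indicator_of_hasCompactSupport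
    (μ := (volume : Measure (ℝ × ℝ)).prod (volume : Measure ℝ)) hF2 hF3 hS
  rw [← integral_indicator hS, Measure.volume_eq_prod, integral_prod _ hint]
  refine integral_congr_ae (Eventually.of_forall fun q => ?_)
  have hcurve (t : ℝ) : HasDerivAt (fun t : ℝ => (q, t)) ((0, 1) : (ℝ × ℝ) × ℝ) t :=
    (hasDerivAt_const t q).prodMk (hasDerivAt_id t)
  have hd (t : ℝ) : deriv (fun t => g (q, t)) t = fderiv ℝ g (q, t) (0, 1) :=
    ((hg.differentiable one_ne_zero (q, t)).hasFDerivAt.comp_hasDerivAt t (hcurve t)).deriv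
  have hc : HasCompactSupport fun t => g (q, t) :=
    hasCompactSupport_comp_of_leftInverse hs continuous_snd fun _ => rfl
  have h1 : ContDiff ℝ 1 fun t => g (q, t) := hg.comp (contDiff_const.prodMk contDiff_id)
  have hF := hc.integral_Iic_deriv_eq h1 (u q)
  rw [integral_Iic_eq_integral_Iio] at hF
  simp only [hd] at hF
  simp only
  rw [← hF, ← integral_const_mul, ← integral_indicator measurableSet_Iio]
  refine integral_congr_ae (Eventually.of_forall fun t => ?_)
  by_cases ht : t < u q <;> simp [indicator, ht]

theorem integral_fderiv_apply_eq_zero {E : Type*} [NormedAddCommGroup E] [NormedSpace ℝ E]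
    [MeasurableSpace E] [BorelSpace E] [FiniteDimensional ℝ E] {μ : Measure E}
    [μ.IsAddHaarMeasure] {f : E → ℝ} (hf : ContDiff ℝ 1 f) (hs : HasCompactSupport f) (e : E) :
    ∫ q, fderiv ℝ f q e ∂μ = 0 := by
  have hi : Integrable (fun q => fderiv ℝ f q e) μ :=
    ((hf.continuous_fderiv one_ne_zero).clm_apply continuous_const).integrable_of_hasCompactSupport
      ((hs.fderiv ℝ).comp_left (g := fun L : E →L[ℝ] ℝ => L e) (by simp))
  -- Integration by parts against the constant 1.
  have := integral_mul_fderiv_eq_neg_fderiv_mul_of_integrable (μ := μ) (f := fun _ : E => (1 : ℝ))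
    (g := f) (v := e) (by simp) (by simpa using hi)
    (by simpa using hf.continuous.integrable_of_hasCompactSupport hs)
    (fun x _ => differentiableAt_const _) (fun x _ => hf.differentiable one_ne_zero x)
  simpa using this

/-- The direction (e, 0) is parallel to the boundary t = 0, so by Fubini each slice contributes the
integral of a derivative over the whole plane. -/
theorem integral_lower_halfspace_horizontal (hg : ContDiff ℝ 1 g) (hs : HasCompactSupport g)
    (e : ℝ × ℝ) : ∫ z in {z : (ℝ × ℝ) × ℝ | z.2 < 0}, fderiv ℝ g z (e, 0) = 0 := by
  have hS : MeasurableSet {z : (ℝ × ℝ) × ℝ | z.2 < 0} :=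
    (isOpen_lt continuous_snd continuous_const).measurableSet
  have hint := integrable_indicator_of_hasCompactSupport (μ := volume)
    (continuous_fderiv_apply_const hg (e, 0)) (hasCompactSupport_fderiv_apply_const hs (e, 0)) hS
  rw [← integral_indicator hS, Measure.volume_eq_prod]
  refine (integral_prod_symm _ hint).trans ?_
  refine (integral_congr_ae (Eventually.of_forall fun t => ?_)).trans (integral_zero ℝ ℝ)
  by_cases ht : t < 0
  · have hd (q : ℝ × ℝ) : fderiv ℝ (fun q => g (q, t)) q e = fderiv ℝ g (q, t) (e, 0) := by
      have h1 : HasFDerivAt (fun q : ℝ × ℝ => (q, t))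
          ((ContinuousLinearMap.id ℝ (ℝ × ℝ)).prod 0) q :=
        (hasFDerivAt_id q).prodMk (hasFDerivAt_const t q)
      have h2 := (hg.differentiable one_ne_zero (q, t)).hasFDerivAt.comp q h1
      exact (DFunLike.congr_fun h2.fderiv e).trans (by simp)
    have hc : HasCompactSupport fun q => g (q, t) :=
      hasCompactSupport_comp_of_leftInverse hs continuous_fst fun _ => rfl
    have h1 : ContDiff ℝ 1 fun q => g (q, t) := hg.comp (contDiff_id.prodMk contDiff_const)
    have h0 := integral_fderiv_apply_eq_zero (μ := (volume : Measure (ℝ × ℝ))) h1 hc e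
    simp only [hd] at h0
    simpa [indicator, ht] using h0
  · simp [indicator, ht]

/-- The vertical shear that moves the plane `t = 0` to the graph of `u`. -/
def shear (u : ℝ × ℝ → ℝ) (hu : Continuous u) : (ℝ × ℝ) × ℝ ≃ₜ (ℝ × ℝ) × ℝ where
  toFun z := (z.1, z.2 + u z.1)
  invFun z := (z.1, z.2 - u z.1)
  left_inv z := by simp
  right_inv z := by simp
  continuous_toFun := by fun_prop
  continuous_invFun := by fun_prop

theorem measurePreserving_shear (hu : Continuous u) :
    MeasurePreserving (shear u hu) volume volume :=
  MeasurePreserving.skew_product (MeasurePreserving.id _) (g := fun q t => t + u q)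
    (by fun_prop) (Eventually.of_forall fun q => map_add_right_eq_self volume (u q))

/-- The shear preserves volume and carries (e, 0) to the tangent vector (e, du e), which reduces the
claim to the half-space. Only first derivatives of u enter. -/
theorem integral_below_graph_tangential (hg : ContDiff ℝ 1 g) (hs : HasCompactSupport g)
    (hu : ContDiff ℝ 1 u) (e : ℝ × ℝ) :
    ∫ z in {z : (ℝ × ℝ) × ℝ | z.2 < u z.1}, fderiv ℝ g z (e, fderiv ℝ u z.1 e) = 0 := by
  set Φ := shear u hu.continuous with hΦ
  have hΦd : ContDiff ℝ 1 Φ :=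
    contDiff_fst.prodMk (contDiff_snd.add (hu.comp contDiff_fst))
  have h0 := integral_lower_halfspace_horizontal (g := g ∘ Φ) (hg.comp hΦd)
    (hs.comp_homeomorph Φ) e
  rw [← (measurePreserving_shear hu.continuous).setIntegral_preimage_emb
    Φ.measurableEmbedding]
  refine Eq.trans ?_ h0
  have hpre : Φ ⁻¹' {z : (ℝ × ℝ) × ℝ | z.2 < u z.1} = {z : (ℝ × ℝ) × ℝ | z.2 < 0} := by
    ext z
    simp [hΦ, shear]
  rw [← hΦ, hpre]
  refine integral_congr_ae (Eventually.of_forall fun z => ?_)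
  have h1 : HasFDerivAt Φ ((ContinuousLinearMap.fst ℝ (ℝ × ℝ) ℝ).prod
      (ContinuousLinearMap.snd ℝ (ℝ × ℝ) ℝ +
        (fderiv ℝ u z.1).comp (ContinuousLinearMap.fst ℝ (ℝ × ℝ) ℝ))) z :=
    hasFDerivAt_fst.prodMk (hasFDerivAt_snd.add
      ((hu.differentiable one_ne_zero z.1).hasFDerivAt.comp z hasFDerivAt_fst))
  have h2 := (hg.differentiable one_ne_zero (Φ z)).hasFDerivAt.comp z h1
  refine ((DFunLike.congr_fun h2.fderiv (e, 0)).trans ?_).symm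
  simp [hΦ, shear]

/-- Integration of a directional derivative below a `C¹` graph. -/
theorem integral_below_graph_fderiv (hg : ContDiff ℝ 1 g) (hs : HasCompactSupport g)
    (hu : ContDiff ℝ 1 u) (e : ℝ × ℝ) (c : ℝ) :
    ∫ z in {z : (ℝ × ℝ) × ℝ | z.2 < u z.1}, fderiv ℝ g z (e, c) =
      ∫ q, (c - fderiv ℝ u q e) * g (q, u q) := by
  have hcu : Continuous fun q => fderiv ℝ u q e :=
    (hu.continuous_fderiv one_ne_zero).clm_apply continuous_const
  have h1 := integral_below_graph_tangential hg hs hu e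
  have h2 := integral_below_graph_vertical hg hs hu.continuous
    (h := fun q => c - fderiv ℝ u q e) (continuous_const.sub hcu)
  -- Splitting into a vector tangent to the translated graphs, which contributes nothing, and a
  -- vertical one.
  have hdec (z : (ℝ × ℝ) × ℝ) : fderiv ℝ g z (e, c) =
      fderiv ℝ g z (e, fderiv ℝ u z.1 e) + (c - fderiv ℝ u z.1 e) * fderiv ℝ g z (0, 1) := by
    rw [← smul_eq_mul, ← map_smul, ← map_add]
    congr 1
    ext <;> simp
  have i2 : Integrable fun z : (ℝ × ℝ) × ℝ =>
      (c - fderiv ℝ u z.1 e) * fderiv ℝ g z (0, 1) :=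
    ((continuous_const.sub (hcu.comp continuous_fst)).mul
      (continuous_fderiv_apply_const hg (0, 1))).integrable_of_hasCompactSupport
      ((hasCompactSupport_fderiv_apply_const hs (0, 1)).mul_left)
  have i3 : Integrable fun z : (ℝ × ℝ) × ℝ => fderiv ℝ g z (e, c) :=
    (continuous_fderiv_apply_const hg (e, c)).integrable_of_hasCompactSupport
      (hasCompactSupport_fderiv_apply_const hs (e, c))
  have i1 : Integrable fun z : (ℝ × ℝ) × ℝ => fderiv ℝ g z (e, fderiv ℝ u z.1 e) := by
    refine (i3.sub i2).congr (Eventually.of_forall fun z => ?_)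
    simp [hdec z]
  simp_rw [hdec]
  rw [integral_add i1.integrableOn i2.integrableOn, h1, h2, zero_add]

/-- The divergence theorem below a `C¹` graph. -/
theorem integral_subgraph_divergence {U : H → H} (hU : ContDiff ℝ 1 U) (hs : HasCompactSupport U)
    (hu : ContDiff ℝ 1 u) :
    ∫ p in subgraph u, divergence U p =
      ∫ q : ℝ × ℝ, ((U (q.1, q.2, u q)).2.2 - fderiv ℝ u q (1, 0) * (U (q.1, q.2, u q)).1
        - fderiv ℝ u q (0, 1) * (U (q.1, q.2, u q)).2.1) := by
  let A : ((ℝ × ℝ) × ℝ) ≃L[ℝ] H := ContinuousLinearEquiv.prodAssoc ℝ ℝ ℝ ℝ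
  have hA : MeasurePreserving A volume volume := volume_preserving_prodAssoc
  have hAe : MeasurableEmbedding A := A.toHomeomorph.measurableEmbedding
  rw [← hA.setIntegral_preimage_emb hAe]
  have hpre : A ⁻¹' subgraph u = {z : (ℝ × ℝ) × ℝ | z.2 < u z.1} := rfl
  rw [hpre]
  have hUA : ContDiff ℝ 1 (U ∘ A) := hU.comp A.contDiff
  have hsA : HasCompactSupport (U ∘ A) := hs.comp_homeomorph A.toHomeomorph
  have key (P : H →L[ℝ] ℝ) : ContDiff ℝ 1 (P ∘ U ∘ A) ∧ HasCompactSupport (P ∘ U ∘ A) ∧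
      ∀ z w, fderiv ℝ (P ∘ U ∘ A) z w = P (fderiv ℝ U (A z) (A w)) := by
    refine ⟨P.contDiff.comp hUA, hsA.comp_left (map_zero P), fun z w => ?_⟩
    have h2 := P.hasFDerivAt.comp z
      ((hU.differentiable one_ne_zero (A z)).hasFDerivAt.comp z A.hasFDerivAt)
    rw [h2.fderiv]
    simp
  let P1 : H →L[ℝ] ℝ := ContinuousLinearMap.fst ℝ ℝ (ℝ × ℝ)
  let P2 : H →L[ℝ] ℝ := (ContinuousLinearMap.fst ℝ ℝ ℝ).comp (ContinuousLinearMap.snd ℝ ℝ (ℝ × ℝ))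
  let P3 : H →L[ℝ] ℝ := (ContinuousLinearMap.snd ℝ ℝ ℝ).comp (ContinuousLinearMap.snd ℝ ℝ (ℝ × ℝ))
  have hdiv (z : (ℝ × ℝ) × ℝ) : divergence U (A z) = fderiv ℝ (P1 ∘ U ∘ A) z ((1, 0), 0) +
      fderiv ℝ (P2 ∘ U ∘ A) z ((0, 1), 0) + fderiv ℝ (P3 ∘ U ∘ A) z ((0, 0), 1) := by
    rw [(key P1).2.2, (key P2).2.2, (key P3).2.2]
    rfl
  have hint (P : H →L[ℝ] ℝ) (w : (ℝ × ℝ) × ℝ) : Integrable fun z => fderiv ℝ (P ∘ U ∘ A) z w :=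
    (continuous_fderiv_apply_const (key P).1 w).integrable_of_hasCompactSupport
      (hasCompactSupport_fderiv_apply_const (key P).2.1 w)
  simp_rw [hdiv]
  have hint' (P : H →L[ℝ] ℝ) (e : ℝ × ℝ) (c : ℝ) :
      Integrable fun q => (c - fderiv ℝ u q e) * (P ∘ U ∘ A) (q, u q) := by
    refine Continuous.integrable_of_hasCompactSupport ?_ (HasCompactSupport.mul_left ?_)
    · exact (continuous_const.sub ((hu.continuous_fderiv one_ne_zero).clm_apply
        continuous_const)).mul ((key P).1.continuous.comp (continuous_id.prodMk hu.continuous))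
    · exact hasCompactSupport_comp_of_leftInverse (key P).2.1 continuous_fst fun _ => rfl
  rw [integral_add_add (hint P1 _).integrableOn (hint P2 _).integrableOn (hint P3 _).integrableOn,
    integral_below_graph_fderiv (key P1).1 (key P1).2.1 hu,
    integral_below_graph_fderiv (key P2).1 (key P2).2.1 hu,
    integral_below_graph_fderiv (key P3).1 (key P3).2.1 hu,
    ← integral_add_add (hint' P1 _ _) (hint' P2 _ _) (hint' P3 _ _)]
  refine integral_congr_ae (Eventually.of_forall fun q => ?_)
  have e3 : fderiv ℝ u q (0, 0) = 0 := map_zero (fderiv ℝ u q)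
  simp only [e3]
  simp [P1, P2, P3, A]
  ring

end DivergenceTheorem

/-! ### Perimeter of subgraphs and calibrations. -/

section Calibration

theorem divergence_eq_zero_of_notMem_tsupport {U : H → H} {p : H} (hp : p ∉ tsupport U) :
    divergence U p = 0 := by
  simp [divergence, fderiv_of_notMem_tsupport ℝ hp]

theorem divergence_congr {U V : H → H} {p : H} (h : U =ᶠ[𝓝 p] V) :
    divergence U p = divergence V p := by
  simp only [divergence, h.fderiv_eq]

theorem riemNorm_horizontal {p V : H} (hV : V.2.2 = p.2.1 * V.1 - p.1 * V.2.1) :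
    riemNorm p V = √(V.1 ^ 2 + V.2.1 ^ 2) := by
  rw [riemNorm, hV]
  congr 1
  ring

theorem mul_add_mul_le_sqrt {a b c d : ℝ} (h : a ^ 2 + b ^ 2 ≤ 1) :
    a * c + b * d ≤ √(c ^ 2 + d ^ 2) := by
  refine Real.le_sqrt_of_sq_le ?_
  -- Lagrange's identity: (ac + bd)² + (ad - bc)² = (a² + b²)(c² + d²).
  nlinarith [sq_nonneg (a * d - b * c), mul_nonneg (sub_nonneg.2 h)
    (add_nonneg (sq_nonneg c) (sq_nonneg d))]

variable {u : ℝ × ℝ → ℝ}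

/-- The `X`-component of the (non-normalized) horizontal normal of the graph of `u`. -/
noncomputable def normalX (u : ℝ × ℝ → ℝ) (q : ℝ × ℝ) : ℝ := q.2 - fderiv ℝ u q (1, 0)

/-- The `Y`-component of the (non-normalized) horizontal normal of the graph of `u`. -/
noncomputable def normalY (u : ℝ × ℝ → ℝ) (q : ℝ × ℝ) : ℝ := -q.1 - fderiv ℝ u q (0, 1)

/-- The density of the perimeter of the subgraph of `u`. -/
noncomputable def areaDensity (u : ℝ × ℝ → ℝ) (q : ℝ × ℝ) : ℝ :=
  √(normalX u q ^ 2 + normalY u q ^ 2)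

theorem continuous_normalX (hu : ContDiff ℝ 1 u) : Continuous (normalX u) :=
  continuous_snd.sub ((hu.continuous_fderiv one_ne_zero).clm_apply continuous_const)

theorem continuous_normalY (hu : ContDiff ℝ 1 u) : Continuous (normalY u) :=
  continuous_fst.neg.sub ((hu.continuous_fderiv one_ne_zero).clm_apply continuous_const)

theorem continuous_areaDensity (hu : ContDiff ℝ 1 u) : Continuous (areaDensity u) := by
  have h1 := continuous_normalX hu
  have h2 := continuous_normalY hu
  unfold areaDensity
  fun_prop

/-- The flux density of `U` through the graph of `u`. -/
noncomputable def flux (u : ℝ × ℝ → ℝ) (U : H → H) (q : ℝ × ℝ) : ℝ :=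
  (U (q.1, q.2, u q)).1 * normalX u q + (U (q.1, q.2, u q)).2.1 * normalY u q

theorem continuous_graph (hu : Continuous u) :
    Continuous fun q : ℝ × ℝ => ((q.1, q.2, u q) : H) := by fun_prop

theorem hasCompactSupport_graph {γ : Type*} [Zero γ] {f : H → γ} (hf : HasCompactSupport f) :
    HasCompactSupport fun q : ℝ × ℝ => f (q.1, q.2, u q) :=
  hasCompactSupport_comp_of_leftInverse (i := fun q : ℝ × ℝ => ((q.1, q.2, u q) : H)) hf
    (j := fun p => (p.1, p.2.1)) (by fun_prop) fun _ => rfl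

theorem integrable_flux (hu : ContDiff ℝ 1 u) {U : H → H} (hU : Continuous U)
    (hs : HasCompactSupport U) : Integrable (flux u U) := by
  have h1 := continuous_normalX hu
  have h2 := continuous_normalY hu
  have h3 := hU.comp (continuous_graph hu.continuous)
  refine Continuous.integrable_of_hasCompactSupport
    ((h3.fst.mul h1).add (h3.snd.fst.mul h2)) ?_
  have h4 := hasCompactSupport_graph (u := u) hs
  exact HasCompactSupport.add
    (HasCompactSupport.mul_right (h4.comp_left (g := fun V : H => V.1) rfl))
    (HasCompactSupport.mul_right (h4.comp_left (g := fun V : H => V.2.1) rfl))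

theorem measurableSet_subgraph (hu : Continuous u) : MeasurableSet (subgraph u) :=
  (isOpen_lt continuous_snd.snd
    (hu.comp (continuous_fst.prodMk continuous_snd.fst))).measurableSet

theorem integral_divergence_eq_flux (hu : ContDiff ℝ 1 u) {Ω : Set H} {U : H → H}
    (hU : IsTestField Ω U) : ∫ p in subgraph u ∩ Ω, divergence U p = ∫ q, flux u U q := by
  rw [← setIntegral_eq_of_subset_of_forall_sdiff_eq_zero (measurableSet_subgraph hu.continuous)
    inter_subset_left, integral_subgraph_divergence hU.contDiff hU.compact hu]
  · refine integral_congr_ae (Eventually.of_forall fun q => ?_)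
    have := mem_horizontalPlane.1 (hU.horizontal (q.1, q.2, u q))
    simp only [flux, normalX, normalY, this]
    ring
  · rintro p ⟨hp, hn⟩
    exact divergence_eq_zero_of_notMem_tsupport fun h => hn ⟨hp, hU.support_subset h⟩

theorem IsTestField.sq_add_sq_le {Ω : Set H} {U : H → H} (hU : IsTestField Ω U) (p : H) :
    (U p).1 ^ 2 + (U p).2.1 ^ 2 ≤ 1 := by
  have h := hU.norm_le p
  rw [riemNorm_horizontal (mem_horizontalPlane.1 (hU.horizontal p)), Real.sqrt_le_iff] at h
  simpa using h.2

theorem flux_le_areaDensity {Ω : Set H} {U : H → H} (hU : IsTestField Ω U) (q : ℝ × ℝ) :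
    flux u U q ≤ areaDensity u q :=
  mul_add_mul_le_sqrt (hU.sq_add_sq_le _)

/-- Subgraphs of `C¹` functions have locally finite perimeter. -/
theorem locallyFinitePerimeter_subgraph (hu : ContDiff ℝ 1 u) :
    LocallyFinitePerimeter (subgraph u) := by
  refine ⟨(measurableSet_subgraph hu.continuous).nullMeasurableSet, fun Ω _ hb => ?_⟩
  obtain ⟨R, hR⟩ := hb.subset_closedBall (0 : H)
  set B := Metric.closedBall (0 : ℝ × ℝ) R
  have hBm : MeasurableSet B := Metric.isClosed_closedBall.measurableSet
  have hint : IntegrableOn (areaDensity u) B :=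
    (continuous_areaDensity hu).continuousOn.integrableOn_compact (isCompact_closedBall 0 R)
  refine lt_of_le_of_lt (iSup₂_le fun U hU => ENNReal.ofReal_le_ofReal ?_)
    (ENNReal.ofReal_lt_top (r := ∫ q in B, areaDensity u q))
  rw [integral_divergence_eq_flux hu hU, ← integral_indicator hBm]
  refine integral_mono (integrable_flux hu hU.contDiff.continuous hU.compact)
    (hint.integrable_indicator hBm) fun q => ?_
  by_cases hq : q ∈ B
  · simpa [hq] using flux_le_areaDensity hU q
  · have h0 : U (q.1, q.2, u q) = 0 := by
      by_contra h
      have h1 := hR (hU.support_subset (subset_tsupport _ h))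
      refine hq ?_
      simp only [B, mem_closedBall_zero_iff, Prod.norm_def, max_le_iff] at h1 ⊢
      exact ⟨h1.1, h1.2.1⟩
    simp [hq, flux, h0]

/-- The horizontal field `a X + b Y` whose coefficients do not depend on `t`. -/
def horizontalLift (a b : ℝ × ℝ → ℝ) (p : H) : H :=
  (a (p.1, p.2.1), b (p.1, p.2.1), p.2.1 * a (p.1, p.2.1) - p.1 * b (p.1, p.2.1))

theorem contDiff_horizontalLift {a b : ℝ × ℝ → ℝ} (ha : ContDiff ℝ 1 a) (hb : ContDiff ℝ 1 b) :
    ContDiff ℝ 1 (horizontalLift a b) := by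
  unfold horizontalLift
  fun_prop

/-- The t-component is independent of t, so it adds nothing. -/
theorem divergence_horizontalLift {a b : ℝ × ℝ → ℝ} {p : H} {Da Db : ℝ × ℝ →L[ℝ] ℝ}
    (ha : HasFDerivAt a Da (p.1, p.2.1)) (hb : HasFDerivAt b Db (p.1, p.2.1)) :
    divergence (horizontalLift a b) p = Da (1, 0) + Db (0, 1) := by
  let P : H →L[ℝ] ℝ × ℝ := (ContinuousLinearMap.fst ℝ ℝ (ℝ × ℝ)).prod
    ((ContinuousLinearMap.fst ℝ ℝ ℝ).comp (ContinuousLinearMap.snd ℝ ℝ (ℝ × ℝ)))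
  have h1 : HasFDerivAt (fun p : H => a (p.1, p.2.1)) (Da.comp P) p :=
    HasFDerivAt.comp (g := a) p ha P.hasFDerivAt
  have h2 : HasFDerivAt (fun p : H => b (p.1, p.2.1)) (Db.comp P) p :=
    HasFDerivAt.comp (g := b) p hb P.hasFDerivAt
  have hx : HasFDerivAt (fun p : H => p.1) (ContinuousLinearMap.fst ℝ ℝ (ℝ × ℝ)) p :=
    hasFDerivAt_fst
  have hy : HasFDerivAt (fun p : H => p.2.1)
      ((ContinuousLinearMap.fst ℝ ℝ ℝ).comp (ContinuousLinearMap.snd ℝ ℝ (ℝ × ℝ))) p :=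
    ((ContinuousLinearMap.fst ℝ ℝ ℝ).comp (ContinuousLinearMap.snd ℝ ℝ (ℝ × ℝ))).hasFDerivAt
  have h3 := h1.prodMk (h2.prodMk ((hy.mul h1).sub (hx.mul h2)))
  have h4 : fderiv ℝ (horizontalLift a b) p = _ := h3.fderiv
  rw [divergence, h4]
  have e0 : ((0, 0) : ℝ × ℝ) = 0 := rfl
  simp [P, e0]

/-- Being 1 near each point of C, and not merely on C, makes the derivative of φ vanish there, so
the cutoff does not alter divergences on C. -/
theorem exists_cutoff {C Ω : Set H} (hC : IsCompact C) (hΩ : IsOpen Ω) (h : C ⊆ Ω) :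
    ∃ φ : H → ℝ, ContDiff ℝ 1 φ ∧ HasCompactSupport φ ∧ tsupport φ ⊆ Ω ∧
      (∀ p ∈ C, φ =ᶠ[𝓝 p] fun _ => 1) ∧ ∀ p, φ p ∈ Icc (0 : ℝ) 1 := by
  obtain ⟨K, hK, hCK, hKΩ⟩ := exists_compact_between hC hΩ h
  obtain ⟨φ, h1, h2, h3⟩ := exists_contMDiffMap_one_nhds_of_subset_interior
    (n := 1) (modelWithCornersSelf ℝ H) hC.isClosed hCK
  have hts : tsupport φ ⊆ K := closure_minimal
    (fun p hp => by_contra fun hpK => hp (h2 p hpK)) hK.isClosed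
  refine ⟨φ, φ.contMDiff.contDiff, hK.of_isClosed_subset (isClosed_tsupport _) hts,
    hts.trans hKΩ, fun p hp => ?_, h3⟩
  exact h1.filter_mono (nhds_le_nhdsSet hp)

theorem isTestField_smul_horizontalLift {Ω : Set H} {φ : H → ℝ} (hφ : ContDiff ℝ 1 φ)
    (hs : HasCompactSupport φ) (hΩ : tsupport φ ⊆ Ω) (h01 : ∀ p, φ p ∈ Icc (0 : ℝ) 1)
    {a b : ℝ × ℝ → ℝ} (ha : ContDiff ℝ 1 a) (hb : ContDiff ℝ 1 b)
    (hab : ∀ q, a q ^ 2 + b q ^ 2 ≤ 1) :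
    IsTestField Ω fun p => φ p • horizontalLift a b p where
  contDiff := hφ.smul (contDiff_horizontalLift ha hb)
  horizontal p := by
    refine Submodule.smul_mem _ _ (mem_horizontalPlane.2 rfl)
  norm_le p := by
    rw [riemNorm_horizontal (by simp [horizontalLift]; ring)]
    refine Real.sqrt_le_iff.2 ⟨zero_le_one, ?_⟩
    rw [one_pow]
    have h1 : φ p ^ 2 ≤ 1 := pow_le_one₀ (h01 p).1 (h01 p).2
    have h2 := hab (p.1, p.2.1)
    have h3 : 0 ≤ a (p.1, p.2.1) ^ 2 + b (p.1, p.2.1) ^ 2 := by positivity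
    calc _ = φ p ^ 2 * (a (p.1, p.2.1) ^ 2 + b (p.1, p.2.1) ^ 2) := by
            simp [horizontalLift]; ring
      _ ≤ 1 := mul_le_one₀ h1 h3 h2
  compact := hs.smul_right
  support_subset := (tsupport_smul_subset_left _ _).trans hΩ

/-- If `E` and `F` differ only where the divergence of a test field vanishes, its integrals over
`E` and `F` agree. -/
theorem setIntegral_inter_eq_of_symmDiff {E F Ω K : Set H} (hΩ : IsOpen Ω)
    (hE : NullMeasurableSet E) (hF : NullMeasurableSet F) (hK : symmDiff E F ⊆ K) {f : H → ℝ}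
    (hf : ∀ p ∈ K, f p = 0) : ∫ p in E ∩ Ω, f p = ∫ p in F ∩ Ω, f p := by
  rw [← integral_indicator₀ (hE.inter hΩ.measurableSet.nullMeasurableSet),
    ← integral_indicator₀ (hF.inter hΩ.measurableSet.nullMeasurableSet)]
  congr 1
  ext p
  by_cases hp : p ∈ K
  · simp [indicator, hf p hp]
  · have : p ∈ E ↔ p ∈ F := by
      by_contra h
      refine hp (hK ?_)
      rw [mem_symmDiff]
      tauto
    have h' : p ∈ E ∩ Ω ↔ p ∈ F ∩ Ω := and_congr_left' this
    by_cases h : p ∈ E ∩ Ω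
    · rw [indicator_of_mem h, indicator_of_mem (h'.1 h)]
    · rw [indicator_of_notMem h, indicator_of_notMem (fun hF => h (h'.2 hF))]

/-- Calibration by a sequence of divergence-free horizontal fields: if the fields `aₙ X + bₙ Y`
are divergence-free, of norm at most one, and converge on the graph of `u` to a calibration of its
horizontal normal, then the subgraph of `u` is area-minimizing. -/
theorem areaMinimizing_of_calibration (hu : ContDiff ℝ 1 u) {a b : ℕ → ℝ × ℝ → ℝ}
    (ha : ∀ n, ContDiff ℝ 1 (a n)) (hb : ∀ n, ContDiff ℝ 1 (b n))
    (hab : ∀ n q, a n q ^ 2 + b n q ^ 2 ≤ 1)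
    (hdiv : ∀ n q, fderiv ℝ (a n) q (1, 0) + fderiv ℝ (b n) q (0, 1) = 0)
    (hlim : ∀ q, Tendsto (fun n => a n q * normalX u q + b n q * normalY u q) atTop
      (𝓝 (areaDensity u q))) :
    AreaMinimizing (subgraph u) := by
  intro Ω hΩ
  refine ⟨locallyFinitePerimeter_subgraph hu, fun F hF ⟨K, hK, hKΩ, hEF⟩ => ?_⟩
  refine iSup₂_le fun U hU => ?_
  -- Near K the cutoff must be 1 to keep the fields divergence-free there; on the support of U, to
  -- compare fluxes.
  obtain ⟨φ, hφ, hφs, hφΩ, hφ1, hφ01⟩ := exists_cutoff (hK.union hU.compact.isCompact) hΩ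
    (union_subset hKΩ hU.support_subset)
  let W : ℕ → H → H := fun n p => φ p • horizontalLift (a n) (b n) p
  have hW (n : ℕ) : IsTestField Ω (W n) :=
    isTestField_smul_horizontalLift hφ hφs hφΩ hφ01 (ha n) (hb n) (hab n)
  have hdivW (n : ℕ) (p : H) (hp : p ∈ K) : divergence (W n) p = 0 := by
    have h1 : W n =ᶠ[𝓝 p] horizontalLift (a n) (b n) := by
      filter_upwards [hφ1 p (Or.inl hp)] with p' hp'
      simp [W, hp']
    rw [divergence_congr h1, divergence_horizontalLift
      ((ha n).differentiable one_ne_zero _).hasFDerivAt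
      ((hb n).differentiable one_ne_zero _).hasFDerivAt, hdiv]
  have hE := (measurableSet_subgraph hu.continuous).nullMeasurableSet (μ := volume)
  -- The divergence of `W n` vanishes where the two sets differ, so its integral over the subgraph
  -- is also its integral over F.
  have hbound (n : ℕ) : ENNReal.ofReal (∫ q, flux u (W n) q) ≤ perimeter F Ω := by
    rw [← integral_divergence_eq_flux hu (hW n),
      setIntegral_inter_eq_of_symmDiff hΩ hE hF hEF (hdivW n)]
    exact le_iSup₂ (f := fun (U : H → H) (_ : IsTestField Ω U) =>
      ENNReal.ofReal (∫ p in F ∩ Ω, divergence U p)) (W n) (hW n)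
  have hfluxW (n : ℕ) (q : ℝ × ℝ) : flux u (W n) q =
      φ (q.1, q.2, u q) * (a n q * normalX u q + b n q * normalY u q) := by
    simp [flux, W, horizontalLift]
    ring
  have hφc : Continuous fun q : ℝ × ℝ => φ (q.1, q.2, u q) :=
    hφ.continuous.comp (continuous_graph hu.continuous)
  have hdens : Integrable fun q => φ (q.1, q.2, u q) * areaDensity u q :=
    (hφc.mul (continuous_areaDensity hu)).integrable_of_hasCompactSupport
      (HasCompactSupport.mul_right (hasCompactSupport_graph hφs))
  have htend : Tendsto (fun n => ∫ q, flux u (W n) q) atTop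
      (𝓝 (∫ q, φ (q.1, q.2, u q) * areaDensity u q)) := by
    refine tendsto_integral_of_dominated_convergence
      (fun q => φ (q.1, q.2, u q) * areaDensity u q)
      (fun n => (integrable_flux hu (hW n).contDiff.continuous (hW n).compact).1) hdens
      (fun n => Eventually.of_forall fun q => ?_) (Eventually.of_forall fun q => ?_)
    · rw [hfluxW, Real.norm_eq_abs, abs_mul, abs_of_nonneg (hφ01 _).1]
      refine mul_le_mul_of_nonneg_left (abs_le'.2 ⟨?_, ?_⟩) (hφ01 _).1
      · exact mul_add_mul_le_sqrt (hab n q)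
      · have := mul_add_mul_le_sqrt (a := -a n q) (b := -b n q) (c := normalX u q)
          (d := normalY u q) (by simpa using hab n q)
        unfold areaDensity
        linarith
    · simp only [hfluxW]
      exact (hlim q).const_mul _
  have hlast := le_of_tendsto' ((ENNReal.continuous_ofReal.tendsto _).comp htend) hbound
  refine le_trans (ENNReal.ofReal_le_ofReal ?_) hlast
  rw [integral_divergence_eq_flux hu hU]
  refine integral_mono (integrable_flux hu hU.contDiff.continuous hU.compact) hdens fun q => ?_
  by_cases hq : (q.1, q.2, u q) ∈ tsupport U
  · have h1 : φ (q.1, q.2, u q) = 1 := (hφ1 _ (Or.inr hq)).self_of_nhds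
    simpa [h1] using flux_le_areaDensity hU q
  · have h0 : U (q.1, q.2, u q) = 0 := image_eq_zero_of_notMem_tsupport hq
    have : flux u U q = 0 := by simp [flux, h0]
    rw [this]
    exact mul_nonneg (hφ01 _).1 (Real.sqrt_nonneg _)

end Calibration

/-! ### The calibration of Σ_β. -/

section Minimality

variable {β : ℝ → ℝ}

/-- The sine of the angle `α(v)`. -/
noncomputable def sinAngle (β : ℝ → ℝ) (v : ℝ) : ℝ := (√(1 + β v ^ 2))⁻¹

theorem sqrt_one_add_sq_pos (b : ℝ) : 0 < √(1 + b ^ 2) := Real.sqrt_pos.2 (by positivity)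

theorem contDiff_sinAngle (hβ : ContDiff ℝ 1 β) : ContDiff ℝ 1 (sinAngle β) := by
  have h : ContDiff ℝ 1 fun v => 1 + β v ^ 2 := by fun_prop
  exact (h.sqrt fun v => by positivity).inv fun v => (sqrt_one_add_sq_pos (β v)).ne'

theorem sinAngle_sq_mul (v : ℝ) : sinAngle β v ^ 2 * (1 + β v ^ 2) = 1 := by
  have h : √(1 + β v ^ 2) ^ 2 = 1 + β v ^ 2 := Real.sq_sqrt (by positivity)
  rw [sinAngle, inv_pow, h, inv_mul_cancel₀ (by positivity)]

/-- The sine and cosine of `α` satisfy `sin' + β cos' = 0`. -/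
theorem deriv_sinAngle_add (hβ : ContDiff ℝ 1 β) (v : ℝ) :
    deriv (sinAngle β) v +
      β v * (deriv β v * sinAngle β v + β v * deriv (sinAngle β) v) = 0 := by
  have hd : HasDerivAt β (deriv β v) v := (hβ.differentiable one_ne_zero v).hasDerivAt
  have hs : HasDerivAt (sinAngle β) (deriv (sinAngle β) v) v :=
    ((contDiff_sinAngle hβ).differentiable one_ne_zero v).hasDerivAt
  -- Differentiate sin² α (1 + β²) = 1, then divide by 2 sin α.
  have h1 := (hs.fun_pow 2).mul ((hd.fun_pow 2).const_add 1)
  have h2 := h1.unique ((hasDerivAt_const v (1 : ℝ)).congr_of_eventuallyEq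
    (Eventually.of_forall fun w => sinAngle_sq_mul w))
  have hpos : 0 < sinAngle β v := inv_pos.2 (sqrt_one_add_sq_pos _)
  have h3 : 2 * sinAngle β v * (deriv (sinAngle β) v +
      β v * (deriv β v * sinAngle β v + β v * deriv (sinAngle β) v)) = 0 := by
    simp at h2
    linear_combination h2
  exact (mul_eq_zero.1 h3).resolve_left (by positivity)

/-- A smooth regularization of `|y|`. -/
noncomputable def smoothAbs (ε y : ℝ) : ℝ := √(y ^ 2 + ε ^ 2)

theorem smoothAbs_pos {ε : ℝ} (hε : 0 < ε) (y : ℝ) : 0 < smoothAbs ε y :=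
  Real.sqrt_pos.2 (by positivity)

theorem contDiff_smoothAbs {ε : ℝ} (hε : 0 < ε) : ContDiff ℝ 1 (smoothAbs ε) := by
  have h : ContDiff ℝ 1 fun y : ℝ => y ^ 2 + ε ^ 2 := by fun_prop
  exact h.sqrt fun y => by positivity

theorem hasDerivAt_smoothAbs {ε : ℝ} (hε : 0 < ε) (y : ℝ) :
    HasDerivAt (smoothAbs ε) (y / smoothAbs ε y) y := by
  have h : HasDerivAt (fun y : ℝ => y ^ 2 + ε ^ 2) (2 * y) y := by
    simpa using ((hasDerivAt_id y).fun_pow 2).add_const (ε ^ 2)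
  refine (h.sqrt (by positivity)).congr_deriv ?_
  exact mul_div_mul_left y _ two_ne_zero

/-- The regularization of `ξ_β` in which `|y|` is replaced by a smooth function. -/
noncomputable def smoothFoot (β : ℝ → ℝ) (ε : ℝ) (q : ℝ × ℝ) : ℝ :=
  axisFoot β (q.1, smoothAbs ε q.2)

/-- The `X`-coefficient of the regularized calibration. -/
noncomputable def calibX (β : ℝ → ℝ) (ε : ℝ) (q : ℝ × ℝ) : ℝ :=
  q.2 / smoothAbs ε q.2 * sinAngle β (smoothFoot β ε q)

/-- The `Y`-coefficient of the regularized calibration. -/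
noncomputable def calibY (β : ℝ → ℝ) (ε : ℝ) (q : ℝ × ℝ) : ℝ :=
  -(β (smoothFoot β ε q) * sinAngle β (smoothFoot β ε q))

theorem contDiff_smoothFoot (hβ : ContDiff ℝ 1 β) (hm : Monotone β) {ε : ℝ} (hε : 0 < ε) :
    ContDiff ℝ 1 (smoothFoot β ε) := by
  refine contDiff_iff_contDiffAt.2 fun q => ?_
  refine ContDiffAt.comp q (g := axisFoot β) (f := fun q : ℝ × ℝ => (q.1, smoothAbs ε q.2))
    (contDiffAt_axisFoot one_ne_zero hβ hm (smoothAbs_pos hε _)) ?_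
  exact contDiffAt_fst.prodMk ((contDiff_smoothAbs hε).comp contDiff_snd).contDiffAt

/-- Only the ratio of the two partial derivatives matters: J factors out of the divergence of the
calibration, so its value is left unspecified. -/
theorem hasFDerivAt_smoothFoot (hβ : ContDiff ℝ 1 β) (hm : Monotone β) {ε : ℝ} (hε : 0 < ε)
    (q : ℝ × ℝ) : ∃ J : ℝ, HasFDerivAt (smoothFoot β ε) (J • (ContinuousLinearMap.fst ℝ ℝ ℝ -
      (β (smoothFoot β ε q) * (q.2 / smoothAbs ε q.2)) • ContinuousLinearMap.snd ℝ ℝ ℝ)) q := by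
  have h1 : HasFDerivAt (fun p : ℝ × ℝ => (p.1, smoothAbs ε p.2))
      ((ContinuousLinearMap.fst ℝ ℝ ℝ).prod
        ((q.2 / smoothAbs ε q.2) • ContinuousLinearMap.snd ℝ ℝ ℝ)) q :=
    hasFDerivAt_fst.prodMk ((hasDerivAt_smoothAbs hε q.2).comp_hasFDerivAt q hasFDerivAt_snd)
  have h2 := (hasFDerivAt_axisFoot hβ hm (q := (q.1, smoothAbs ε q.2))
    (smoothAbs_pos hε _)).comp q h1
  refine ⟨(1 + smoothAbs ε q.2 * deriv β (smoothFoot β ε q))⁻¹, h2.congr_fderiv ?_⟩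
  ext
  · simp [smoothFoot]
  · simp [smoothFoot]

theorem contDiff_calibX (hβ : ContDiff ℝ 1 β) (hm : Monotone β) {ε : ℝ} (hε : 0 < ε) :
    ContDiff ℝ 1 (calibX β ε) :=
  (contDiff_snd.div ((contDiff_smoothAbs hε).comp contDiff_snd)
    fun q => (smoothAbs_pos hε q.2).ne').mul
    ((contDiff_sinAngle hβ).comp (contDiff_smoothFoot hβ hm hε))

theorem contDiff_calibY (hβ : ContDiff ℝ 1 β) (hm : Monotone β) {ε : ℝ} (hε : 0 < ε) :
    ContDiff ℝ 1 (calibY β ε) :=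
  ((hβ.comp (contDiff_smoothFoot hβ hm hε)).mul
    ((contDiff_sinAngle hβ).comp (contDiff_smoothFoot hβ hm hε))).neg

theorem div_smoothAbs_sq_le (ε y : ℝ) : (y / smoothAbs ε y) ^ 2 ≤ 1 := by
  rw [div_pow, smoothAbs, Real.sq_sqrt (by positivity)]
  exact div_le_one_of_le₀ (by nlinarith [sq_nonneg ε]) (by positivity)

theorem calib_sq_add_sq_le (β : ℝ → ℝ) (ε : ℝ) (q : ℝ × ℝ) :
    calibX β ε q ^ 2 + calibY β ε q ^ 2 ≤ 1 := by
  have h1 := div_smoothAbs_sq_le ε q.2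
  have h2 := sinAngle_sq_mul (β := β) (smoothFoot β ε q)
  have h3 := mul_le_mul_of_nonneg_right h1 (sq_nonneg (sinAngle β (smoothFoot β ε q)))
  rw [calibX, calibY]
  linarith

/-- With ρ = y/√(y² + ε²), the derivative of the regularized |y|, one has ξ_x = J and ξ_y = -β ρ J.
As ρ depends on y alone, the divergence is ρ J (sin' + β cos') = 0. -/
theorem calib_divergence_eq_zero (hβ : ContDiff ℝ 1 β) (hm : Monotone β) {ε : ℝ} (hε : 0 < ε)
    (q : ℝ × ℝ) : fderiv ℝ (calibX β ε) q (1, 0) + fderiv ℝ (calibY β ε) q (0, 1) = 0 := by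
  obtain ⟨J, hJ⟩ := hasFDerivAt_smoothFoot hβ hm hε q
  set v := smoothFoot β ε q with hv
  have hd : HasDerivAt β (deriv β v) v := (hβ.differentiable one_ne_zero v).hasDerivAt
  have hs : HasDerivAt (sinAngle β) (deriv (sinAngle β) v) v :=
    ((contDiff_sinAngle hβ).differentiable one_ne_zero v).hasDerivAt
  have hρd : DifferentiableAt ℝ (fun y => y / smoothAbs ε y) q.2 :=
    differentiableAt_id.div (hasDerivAt_smoothAbs hε q.2).differentiableAt
      (smoothAbs_pos hε q.2).ne'
  have hρ : HasFDerivAt (fun p : ℝ × ℝ => p.2 / smoothAbs ε p.2) _ q :=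
    hρd.hasDerivAt.comp_hasFDerivAt q (hasFDerivAt_snd (𝕜 := ℝ))
  have hX' := hρ.mul (hs.comp_hasFDerivAt q hJ)
  have hY' := ((hd.mul hs).comp_hasFDerivAt q hJ).neg
  have hX : HasFDerivAt (calibX β ε) _ q := hX'
  have hY : HasFDerivAt (calibY β ε) _ q := hY'
  rw [hX.fderiv, hY.fderiv]
  simp [← hv]
  linear_combination (q.2 / smoothAbs ε q.2 * J) * deriv_sinAngle_add hβ v

theorem normalX_height (hβ : ContDiff ℝ 1 β) (hm : Monotone β) (q : ℝ × ℝ) :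
    normalX (height β) q = q.2 * (1 + footSlope β q) := by
  rw [normalX, fderiv_height hβ hm]
  simp [heightDeriv]
  ring

theorem normalY_height (hβ : ContDiff ℝ 1 β) (hm : Monotone β) (q : ℝ × ℝ) :
    normalY (height β) q = -(|q.2| * β (foot β q) * (1 + footSlope β q)) := by
  have h := foot_spec hβ.continuous hm q
  rw [normalY, fderiv_height hβ hm]
  simp [heightDeriv]
  linear_combination h

theorem areaDensity_height (hβ : ContDiff ℝ 1 β) (hm : Monotone β) (q : ℝ × ℝ) :
    areaDensity (height β) q =
      (1 + footSlope β q) * (|q.2| * sinAngle β (foot β q) * (1 + β (foot β q) ^ 2)) := by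
  have h0 := footSlope_pos hm q
  have h1 : 0 < sinAngle β (foot β q) := inv_pos.2 (sqrt_one_add_sq_pos _)
  have h2 := sinAngle_sq_mul (β := β) (foot β q)
  rw [areaDensity, normalX_height hβ hm, normalY_height hβ hm,
    Real.sqrt_eq_iff_mul_self_eq (by positivity) (by positivity)]
  have h3 : |q.2| ^ 2 = q.2 ^ 2 := sq_abs _
  linear_combination (-(1 + footSlope β q) ^ 2 * |q.2| ^ 2 * (1 + β (foot β q) ^ 2)) * h2 -
    (1 + footSlope β q) ^ 2 * h3

theorem tendsto_smoothAbs {ε : ℕ → ℝ} (hε : Tendsto ε atTop (𝓝 0)) (y : ℝ) :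
    Tendsto (fun n => smoothAbs (ε n) y) atTop (𝓝 |y|) := by
  have h : Continuous fun e : ℝ => smoothAbs e y := by
    unfold smoothAbs
    fun_prop
  have := (h.tendsto 0).comp hε
  simpa [smoothAbs, Function.comp_def, Real.sqrt_sq_eq_abs] using this

theorem tendsto_smoothFoot (hc : Continuous β) (hm : Monotone β) {ε : ℕ → ℝ}
    (hε : Tendsto ε atTop (𝓝 0)) (q : ℝ × ℝ) :
    Tendsto (fun n => smoothFoot β (ε n) q) atTop (𝓝 (foot β q)) := by
  rw [foot_eq hc hm]
  -- Continuity on the closed half-plane r ≥ 0 is needed, since |y| may be 0.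
  refine Tendsto.comp (continuousOn_axisFoot hc hm (q.1, |q.2|) (abs_nonneg q.2)) ?_
  refine tendsto_nhdsWithin_iff.2 ⟨tendsto_const_nhds.prodMk_nhds (tendsto_smoothAbs hε q.2),
    Eventually.of_forall fun n => Real.sqrt_nonneg _⟩

/-- Off the axis the fields tend to the unit horizontal normal. On the axis that normal vanishes, so
both sides are zero and the jump of the limit field is harmless. -/
theorem tendsto_calib (hβ : ContDiff ℝ 1 β) (hm : Monotone β) {ε : ℕ → ℝ}
    (hε : Tendsto ε atTop (𝓝 0)) (q : ℝ × ℝ) :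
    Tendsto (fun n => calibX β (ε n) q * normalX (height β) q +
      calibY β (ε n) q * normalY (height β) q) atTop (𝓝 (areaDensity (height β) q)) := by
  have hc := hβ.continuous
  have hv := tendsto_smoothFoot hc hm hε q
  have hb := (hc.tendsto (foot β q)).comp hv
  have hs := ((contDiff_sinAngle hβ).continuous.tendsto (foot β q)).comp hv
  rw [normalX_height hβ hm, normalY_height hβ hm, areaDensity_height hβ hm]
  rcases eq_or_ne q.2 0 with hq | hq
  · simp [hq]
  · have hr := ((tendsto_const_nhds (x := q.2)).div (tendsto_smoothAbs hε q.2)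
      (abs_ne_zero.2 hq))
    have h := ((hr.mul hs).mul_const (q.2 * (1 + footSlope β q))).add
      ((hb.mul hs).neg.mul_const (-(|q.2| * β (foot β q) * (1 + footSlope β q))))
    have e : q.2 * q.2 = |q.2| * |q.2| := (abs_mul_abs_self q.2).symm
    have e' : (1 + footSlope β q) * (|q.2| * sinAngle β (foot β q) * (1 + β (foot β q) ^ 2)) =
        q.2 / |q.2| * sinAngle β (foot β q) * (q.2 * (1 + footSlope β q)) +
          -(β (foot β q) * sinAngle β (foot β q)) *
            -(|q.2| * β (foot β q) * (1 + footSlope β q)) := by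
      field_simp
      linear_combination (-((1 + footSlope β q) * sinAngle β (foot β q))) * e
    rw [e']
    exact h

theorem areaMinimizing_subgraph_height (hβ : ContDiff ℝ 2 β) (hm : Monotone β) :
    AreaMinimizing (subgraph (height β)) := by
  have hβ1 : ContDiff ℝ 1 β := hβ.of_le (by norm_num)
  have hpos (n : ℕ) : (0 : ℝ) < 1 / ((n : ℝ) + 1) := by positivity
  exact areaMinimizing_of_calibration (contDiff_height hβ hm)
    (a := fun n : ℕ => calibX β (1 / ((n : ℝ) + 1)))
    (b := fun n : ℕ => calibY β (1 / ((n : ℝ) + 1)))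
    (fun n => contDiff_calibX hβ1 hm (hpos n)) (fun n => contDiff_calibY hβ1 hm (hpos n))
    (fun n q => calib_sq_add_sq_le β _ q) (fun n q => calib_divergence_eq_zero hβ1 hm (hpos n) q)
    (tendsto_calib hβ1 hm tendsto_one_div_add_atTop_nhds_zero_nat)

end Minimality

end Heis

theorem mainTheorem3 (β : ℝ → ℝ) (k : ℕ∞) (hk : 2 ≤ k)
    (hβ : ContDiff ℝ (k : WithTop ℕ∞) β) (hmono : Monotone β) :
    -- `Σ_β` is the graph of `u_β`, and `ξ_β` is well defined
    (∀ x y t : ℝ, (x, y, t) ∈ Heis.surface β ↔ t = Heis.height β (x, y)) ∧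
    (∀ x y v : ℝ, (x, y, Heis.height β (x, y)) ∈ Heis.halflines β v ↔ v = Heis.foot β (x, y)) ∧
    -- `u_β` is `C^k` off the `x`-axis
    ContDiffOn ℝ (k : WithTop ℕ∞) (Heis.height β) {q : ℝ × ℝ | q.2 ≠ 0} ∧
    -- `u_β` is (locally) `C^{1,1}`
    (ContDiff ℝ 1 (Heis.height β) ∧ LocallyLipschitz (fderiv ℝ (Heis.height β))) ∧
    -- the one-sided second derivatives in `y` on the `x`-axis are `± 2 β(x)`
    (∀ x : ℝ,
      HasDerivWithinAt (fun y : ℝ => deriv (fun s : ℝ => Heis.height β (x, s)) y)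
        (2 * β x) (Set.Ici 0) 0 ∧
      HasDerivWithinAt (fun y : ℝ => deriv (fun s : ℝ => Heis.height β (x, s)) y)
        (-(2 * β x)) (Set.Iic 0) 0) ∧
    -- so `u_β` is not `C²` near the points of the `x`-axis where `β ≠ 0`
    (∀ x : ℝ, β x ≠ 0 → ¬ ContDiffAt ℝ 2 (Heis.height β) (x, 0)) ∧
    -- `u_β` is `C^∞` in `ξ_β⁻¹(I)` when `β` vanishes on the open set `I`
    (∀ I : Set ℝ, IsOpen I → (∀ v ∈ I, β v = 0) →
      IsOpen (Heis.foot β ⁻¹' I) ∧ ContDiffOn ℝ ∞ (Heis.height β) (Heis.foot β ⁻¹' I)) ∧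
    -- `Σ_β` is area-minimizing
    Heis.AreaMinimizing (Heis.subgraph (Heis.height β)) ∧
    -- the singular set projects exactly onto the `x`-axis
    Heis.proj '' Heis.singularSet (Heis.surface β) = {q : ℝ × ℝ | q.2 = 0} := by
  have hk1 : (1 : WithTop ℕ∞) ≤ k := by exact_mod_cast le_trans one_le_two hk
  have hk0 : k ≠ 0 := fun h => by simp [h] at hk
  have hβ2 : ContDiff ℝ 2 β := hβ.of_le (WithTop.coe_le_coe.2 hk)
  have hβ1 : ContDiff ℝ 1 β := hβ.of_le hk1
  have hc := hβ.continuous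
  refine ⟨fun x y t => Heis.mem_surface_iff_eq_height hc hmono, fun x y v => ?_,
    Heis.contDiffOn_height hk0 hβ hmono, ⟨Heis.contDiff_height hβ2 hmono, ?_⟩,
    Heis.hasDerivWithinAt_deriv_height hβ1 hmono,
    fun x hx => Heis.not_contDiffAt_two_height hβ1 hmono hx,
    fun I hI h0 => ⟨hI.preimage (Heis.continuous_foot hc hmono),
      Heis.contDiffOn_height_preimage hc hmono h0⟩,
    Heis.areaMinimizing_subgraph_height hβ2 hmono, Heis.proj_singularSet_surface hβ1 hmono⟩
  · rw [Heis.mem_halflines_height hc hmono, Heis.foot_eq hc hmono]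
  · rw [Heis.fderiv_height hβ1 hmono]
    exact Heis.locallyLipschitz_heightDeriv hβ2 hmono
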